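/- Let $p:[0,1]\to\mathbb{C}$ be continuous with $|p(0)|=|p(1)|=1$, and suppose that on $(0,1)$ it is an injective, regular ($p'\neq0$) $C^1$ curve with values in the open unit disk $B(0,1)$ and of finite length. Put $\Gamma=p((0,1))$, and suppose that $B(0,1)\setminus\Gamma$ is the union of two disjoint domains $D$ and $D'$ (the domain $D$ is called a lune), where $\Gamma$ is oriented by $p$ as a part of the positively oriented boundary of $D$, i.e. $D$ lies on the left of $\Gamma$. Let $\gamma:[0,\infty)\to B(0,1)\setminus D$ be a $C^1$ curve with $\gamma(0)=0$ that meets $\Gamma$ transversally at the origin: $0=p(s_0)\in\Gamma$ for some $s_0\in(0,1)$, and the tangent vectors $p'(s_0)$ and $\gamma'(0)$ are linearly independent over $\mathbb{R}$. Then $\gamma(t)\notin\Gamma$ for all sufficiently small $t>0$. Moreover, let $t_N\ge 0$ $(N\in\mathbb{N})$ be any sequence such that $\gamma(t_N)\to0$ as $N\to\infty$ and $\gamma(t_N)\notin\Gamma$ for all sufficiently large $N$. Then for every function $u\in C(\overline D)$ that is holomorphic in $D$, the integrals below converge absolutely for all sufficiently large $N$ and all $z\in D$, and $$ u(z)=\frac1{2\pi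 i}\lim_{N\to\infty}\int_\Gamma\frac{u(\zeta)}{\zeta-z}\left(\frac{z-\gamma(t_N)}{\zeta-\gamma(t_N)}\right)^{N+1}d\zeta \qquad(z\in D), $$ where the convergence is uniform in $z$ on compact subsets of $D$. -/

import Mathlib

open Set Filter Topology Metric

noncomputable section

/-- A domain in the plane: a nonempty connected open set. -/
def IsPlaneDomain (U : Set ℂ) : Prop := IsOpen U ∧ IsConnected U

/-- The trace in the open unit disk of an arc `p` parametrized by `[0, 1]`; the two end points,
which will lie on the unit circle, do not belong to it. -/
def arcTrace (p : ℝ → ℂ) : Set ℂ := p '' Ioo 0 1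

/-- `p` parametrizes a smooth curve in the unit disk: a simple, regular `C¹` arc of finite length
that lies in the open unit disk and runs from the unit circle to the unit circle.
(Differentiability is not required at the two end points.) -/
structure IsSmoothCrosscut (p : ℝ → ℂ) : Prop where
  continuousOn : ContinuousOn p (Icc 0 1)
  contDiffOn : ContDiffOn ℝ 1 p (Ioo 0 1)
  deriv_ne_zero : ∀ s ∈ Ioo (0 : ℝ) 1, deriv p s ≠ 0
  injOn : InjOn p (Ioo 0 1)
  mapsTo : MapsTo p (Ioo 0 1) (ball 0 1)
  norm_left : ‖p 0‖ = 1
  norm_right : ‖p 1‖ = 1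
  finite_length : IntervalIntegrable (deriv p) MeasureTheory.volume 0 1

/-- The curve `p` divides the unit disk into two domains, one of which is `D`, and `p` is oriented
as a part of the positively oriented boundary of `D`, that is, `D` lies on the left of `p`. -/
structure IsLune (p : ℝ → ℂ) (D : Set ℂ) : Prop where
  isSmoothCrosscut : IsSmoothCrosscut p
  isPlaneDomain : IsPlaneDomain D
  divides : ∃ D' : Set ℂ, IsPlaneDomain D' ∧ Disjoint D D' ∧ D ∪ D' = ball 0 1 \ arcTrace p
  left_side : ∀ s ∈ Ioo (0 : ℝ) 1,
    ∀ᶠ ε : ℝ in 𝓝[>] 0, p s + (ε : ℂ) * (Complex.I * deriv p s) ∈ D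

/-- The contour integral `∫_p f(ζ) dζ`. -/
def arcIntegral (p : ℝ → ℂ) (f : ℂ → ℂ) : ℂ := ∫ s in (0 : ℝ)..1, f (p s) * deriv p s

/-- Existence of the contour integral `∫_p f(ζ) dζ` as an absolutely convergent integral. -/
def ArcIntegrable (p : ℝ → ℂ) (f : ℂ → ℂ) : Prop :=
  IntervalIntegrable (fun s => f (p s) * deriv p s) MeasureTheory.volume 0 1

/-- The integrand `u(ζ) / (ζ - z) * ((z - a) / (ζ - a)) ^ (N + 1)`. -/
def carlemanIntegrand (u : ℂ → ℂ) (a z : ℂ) (N : ℕ) (ζ : ℂ) : ℂ :=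
  u ζ / (ζ - z) * ((z - a) / (ζ - a)) ^ (N + 1)

/-- The arc `γ : [0, ∞) → ℂ` starts at a point of the arc `p` and is transversal to it there:
the two tangent vectors are linearly independent over `ℝ`. -/
def TransversalAtStart (p γ : ℝ → ℂ) : Prop :=
  ∃ s ∈ Ioo (0 : ℝ) 1, p s = γ 0 ∧
    LinearIndependent ℝ ![deriv p s, derivWithin γ (Ici 0) 0]

end

/-! Fix a compact `K` in `D`, contained in the disk `|z| ≤ ρ < 1`, and `z` in `K`. For `a` off
`closure D`, the function `v ζ = u ζ * ((z - a) / (ζ - a)) ^ (N + 1)` is holomorphic in `D`,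
continuous on its closure, and `v z = u z`. When `a` is near `0`, the base of the power has modulus
at most some `q < 1` wherever `|ζ| ≥ r > ρ`. Thus the unknown part of the boundary, on the unit
circle, contributes little to Cauchy's formula for `v`, and what remains is the integral over the
arc.

Nothing is assumed about `u` or the arc at the circle beyond continuity and finite length, so the
boundary there is cut off: a radial `χ`, equal to `1` on `|ζ| ≤ r` and supported in the open disk,
gives a Cauchy–Pompeiu formula (`IsLune.arcIntegral_cutoff_eq`). The error terms carry `1 - χ` on
the arc or `∂χ/∂z̄` on `D`; both vanish for `|ζ| < r`, so the error is `O(q ^ (N + 1))` uniformly on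
`K` (`IsLune.exists_norm_carleman_sub_le`).

The formula rests on Green's formula `IsLune.arcIntegral_mul_eq`, proved locally and glued by a
partition of unity. Near the arc it needs coordinates in which `D` is exactly the upper half of a
box (`IsLune.exists_box`); the topological point is that the other domain touches every point of the
arc. Transversality serves only to show that `γ` leaves the arc at once. -/

/-! ### The operator `∂/∂z̄` and the weak form of Cauchy's theorem -/

/-- Twice the Wirtinger derivative `∂φ/∂z̄`. -/
noncomputable def twoDbar (φ : ℂ → ℂ) (z : ℂ) : ℂ :=
  fderiv ℝ φ z 1 + Complex.I * fderiv ℝ φ z Complex.I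

theorem realLinearMap_apply_eq (L : ℂ →L[ℝ] ℂ) (w : ℂ) :
    L w = (w.re : ℂ) * L 1 + (w.im : ℂ) * L Complex.I := by
  conv_lhs => rw [show w = w.re • (1 : ℂ) + w.im • Complex.I by simp]
  rw [map_add, map_smul, map_smul]
  simp

/-- The complex linear part of `L` cancels in `L v * w - v * L w`, so only the antilinear part
survives. With `L` the differential of `F`, this is the identity `d(F dζ) = (∂F/∂ζ̄) dζ̄ ∧ dζ`
evaluated on two vectors. -/
theorem realLinearMap_apply_mul (L : ℂ →L[ℝ] ℂ) (v w : ℂ) :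
    L v * w = v * L w
      - Complex.I * ((L 1 + Complex.I * L Complex.I) * ((w.re * v.im - w.im * v.re : ℝ) : ℂ)) := by
  rw [realLinearMap_apply_eq L v, realLinearMap_apply_eq L w]
  generalize L 1 = a
  generalize L Complex.I = b
  conv_lhs => rw [← Complex.re_add_im w]
  conv_rhs => enter [1, 1]; rw [← Complex.re_add_im v]
  push_cast
  ring_nf
  simp only [Complex.I_sq]
  ring

theorem twoDbar_mul_of_differentiableAt {φ u : ℂ → ℂ} {z : ℂ} (hφ : DifferentiableAt ℝ φ z)
    (hu : DifferentiableAt ℂ u z) :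
    twoDbar (fun w => φ w * u w) z = twoDbar φ z * u z := by
  have h1 : HasFDerivAt u ((fderiv ℂ u z).restrictScalars ℝ) z :=
    hu.hasFDerivAt.restrictScalars ℝ
  have h2 := (hφ.hasFDerivAt.mul h1).fderiv
  have h3 : fderiv ℂ u z Complex.I = Complex.I * fderiv ℂ u z 1 := by
    rw [← smul_eq_mul, ← map_smul]; simp
  simp only [twoDbar]
  erw [h2]
  simp [h3]
  ring_nf
  simp only [Complex.I_sq]
  ring

theorem ContDiff.continuous_twoDbar {φ : ℂ → ℂ} (hφ : ContDiff ℝ 1 φ) :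
    Continuous (twoDbar φ) := by
  have := hφ.continuous_fderiv one_ne_zero
  unfold twoDbar
  fun_prop

theorem twoDbar_add {φ ψ : ℂ → ℂ} {z : ℂ} (hφ : DifferentiableAt ℝ φ z)
    (hψ : DifferentiableAt ℝ ψ z) :
    twoDbar (fun w => φ w + ψ w) z = twoDbar φ z + twoDbar ψ z := by
  simp only [twoDbar, fderiv_fun_add hφ hψ, add_apply]
  ring

theorem twoDbar_sum {ι : Type*} (s : Finset ι) {φ : ι → ℂ → ℂ} {z : ℂ}
    (hφ : ∀ i ∈ s, DifferentiableAt ℝ (φ i) z) :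
    twoDbar (fun w => ∑ i ∈ s, φ i w) z = ∑ i ∈ s, twoDbar (φ i) z := by
  simp only [twoDbar, fderiv_fun_sum hφ, sum_apply, Finset.mul_sum, Finset.sum_add_distrib]

theorem support_twoDbar_subset (φ : ℂ → ℂ) : Function.support (twoDbar φ) ⊆ tsupport φ := by
  intro z hz
  by_contra h
  have : fderiv ℝ φ z = 0 := by
    by_contra h'
    exact h (support_fderiv_subset ℝ h')
  simp [twoDbar, this] at hz

theorem HasCompactSupport.integral_fderiv_eq_zero {F : ℂ → ℂ} (hF : ContDiff ℝ 1 F)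
    (hc : HasCompactSupport F) (v : ℂ) : ∫ z, fderiv ℝ F z v = 0 := by
  have h := integral_mul_fderiv_eq_neg_fderiv_mul_of_integrable (𝕜 := ℂ)
    (μ := MeasureTheory.volume) (f := fun _ : ℂ => (1 : ℂ)) (g := F) (v := v)
  have hcont : Continuous (fun z => fderiv ℝ F z v) :=
    (hF.continuous_fderiv one_ne_zero).clm_apply continuous_const
  have hcs : HasCompactSupport (fun z => fderiv ℝ F z v) := hc.fderiv_apply (𝕜 := ℝ) v
  simpa using h (by simp) (by simpa using hcont.integrable_of_hasCompactSupport hcs)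
    (by simpa using hF.continuous.integrable_of_hasCompactSupport hc)
    (by simp) (fun x _ => hF.differentiable one_ne_zero x)

/-- Cauchy's theorem in distributional form: `∂u/∂z̄ = 0` weakly where `u` is holomorphic. -/
theorem setIntegral_twoDbar_mul_eq_zero {U : Set ℂ} (hU : IsOpen U) {φ u : ℂ → ℂ}
    (hφ : ContDiff ℝ 1 φ) (hc : HasCompactSupport φ) (hs : tsupport φ ⊆ U)
    (hu : DifferentiableOn ℂ u U) : ∫ z in U, twoDbar φ z * u z = 0 := by
  have hF : ContDiff ℝ 1 (fun z => φ z * u z) := by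
    rw [← contMDiff_iff_contDiff]
    refine contMDiff_of_tsupport fun x hx => ?_
    have hxU := hs (tsupport_mul_subset_left hx)
    rw [contMDiffAt_iff_contDiffAt]
    exact hφ.contDiffAt.mul
      (((hu.contDiffOn hU).contDiffAt (hU.mem_nhds hxU)).restrict_scalars ℝ)
  have hFc : HasCompactSupport (fun z => φ z * u z) := hc.mul_right
  rw [MeasureTheory.setIntegral_eq_integral_of_forall_compl_eq_zero]
  · have : ∀ z, twoDbar φ z * u z = twoDbar (fun z => φ z * u z) z := by
      intro z
      by_cases hz : z ∈ U
      · exact (twoDbar_mul_of_differentiableAt (hφ.differentiable one_ne_zero z)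
          (hu.differentiableAt (hU.mem_nhds hz))).symm
      · have h1 : twoDbar φ z = 0 := by
          by_contra h; exact hz (hs (support_twoDbar_subset _ h))
        have h2 : twoDbar (fun z => φ z * u z) z = 0 := by
          by_contra h
          exact hz (hs (tsupport_mul_subset_left (support_twoDbar_subset _ h)))
        rw [h1, h2, zero_mul]
    simp_rw [this, twoDbar]
    have hcont : ∀ v, Continuous (fun z => fderiv ℝ (fun z => φ z * u z) z v) := fun v =>
      (hF.continuous_fderiv one_ne_zero).clm_apply continuous_const
    have hint : ∀ v, MeasureTheory.Integrable (fun z => fderiv ℝ (fun z => φ z * u z) z v) :=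
      fun v => (hcont v).integrable_of_hasCompactSupport (hFc.fderiv_apply (𝕜 := ℝ) v)
    rw [MeasureTheory.integral_add (hint 1) ((hint _).const_mul _),
      MeasureTheory.integral_const_mul, hFc.integral_fderiv_eq_zero hF,
      hFc.integral_fderiv_eq_zero hF]
    simp
  · intro z hz
    have : twoDbar φ z = 0 := by
      by_contra h; exact hz (hs (support_twoDbar_subset _ h))
    rw [this, zero_mul]

/-! ### Green's formula in a curvilinear rectangle -/

theorem MeasurableSet.reProdIm {s t : Set ℝ} (hs : MeasurableSet s) (ht : MeasurableSet t) :
    MeasurableSet (s ×ℂ t) :=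
  (Complex.measurable_re hs).inter (Complex.measurable_im ht)

theorem setIntegral_reProdIm_Ioc {f : ℂ → ℂ} {a b c d : ℝ} (hab : a ≤ b) (hcd : c ≤ d)
    (hf : ContinuousOn f (Icc a b ×ℂ Icc c d)) :
    ∫ w in Ioc a b ×ℂ Ioc c d, f w = ∫ x in a..b, ∫ y in c..d, f (x + y * Complex.I) := by
  have h1 := Complex.volume_preserving_equiv_real_prod.symm.setIntegral_preimage_emb
    Complex.measurableEquivRealProd.symm.measurableEmbedding f (Ioc a b ×ℂ Ioc c d)
  have h2 : Complex.measurableEquivRealProd.symm ⁻¹' (Ioc a b ×ℂ Ioc c d) = Ioc a b ×ˢ Ioc c d := by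
    ext ⟨x, y⟩
    simp [Complex.mem_reProdIm, Complex.measurableEquivRealProd]
  have h3 : ∀ q : ℝ × ℝ, Complex.measurableEquivRealProd.symm q = q.1 + q.2 * Complex.I := by
    rintro ⟨x, y⟩
    apply Complex.ext <;> simp [Complex.measurableEquivRealProd]
  rw [← h1, h2, intervalIntegral.integral_of_le hab]
  simp_rw [intervalIntegral.integral_of_le hcd, h3]
  rw [MeasureTheory.Measure.volume_eq_prod, MeasureTheory.setIntegral_prod]
  rw [← MeasureTheory.Measure.volume_eq_prod]
  have hc : ContinuousOn (fun q : ℝ × ℝ => f (q.1 + q.2 * Complex.I)) (Icc a b ×ˢ Icc c d) := by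
    refine hf.comp (by fun_prop) ?_
    rintro ⟨x, y⟩ ⟨hx, hy⟩
    simpa [Complex.mem_reProdIm] using ⟨hx, hy⟩
  exact (hc.integrableOn_compact (isCompact_Icc.prod isCompact_Icc)).mono_set
    (prod_mono Ioc_subset_Icc_self Ioc_subset_Icc_self)

/-- Green's formula in a curvilinear rectangle swept out by translating an arc, for a function
that vanishes on three sides. -/
theorem integral_eq_setIntegral_twoDbar {p p' : ℝ → ℂ} {ν : ℂ} {a b c d : ℝ} (hab : a ≤ b)
    (hcd : c ≤ d) (hp : ∀ s ∈ Icc a b, HasDerivAt p (p' s) s) (hp' : ContinuousOn p' (Icc a b))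
    {U : Set ℂ} (hU : IsOpen U) {F : ℂ → ℂ} (hF : ContDiffOn ℝ 1 F U)
    (hmem : ∀ s ∈ Icc a b, ∀ y ∈ Icc c d, p s + y * ν ∈ U)
    (ha : ∀ y ∈ Icc c d, F (p a + y * ν) = 0) (hb : ∀ y ∈ Icc c d, F (p b + y * ν) = 0)
    (hd : ∀ s ∈ Icc a b, F (p s + d * ν) = 0) :
    ∫ s in a..b, F (p s + c * ν) * p' s =
      Complex.I * ∫ w in Ioc a b ×ℂ Ioc c d, twoDbar F (p w.re + w.im * ν) *
        (((p' w.re).re * ν.im - (p' w.re).im * ν.re : ℝ) : ℂ) := by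
  have hpc : ContinuousOn p (Icc a b) := fun s hs => (hp s hs).continuousAt.continuousWithinAt
  have hdF : ContinuousOn (fderiv ℝ F) U := hF.continuousOn_fderiv_of_isOpen hU le_rfl
  have hFd : ∀ z ∈ U, HasFDerivAt F (fderiv ℝ F z) z := fun z hz =>
    ((hF.differentiableOn one_ne_zero).differentiableAt (hU.mem_nhds hz)).hasFDerivAt
  have hre : MapsTo Complex.re (Icc a b ×ℂ Icc c d) (Icc a b) := fun w hw => hw.1
  have hpre : ContinuousOn (fun w : ℂ => p w.re) (Icc a b ×ℂ Icc c d) :=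
    hpc.comp Complex.continuous_re.continuousOn hre
  have hp're : ContinuousOn (fun w : ℂ => p' w.re) (Icc a b ×ℂ Icc c d) :=
    hp'.comp Complex.continuous_re.continuousOn hre
  have hΦ : ContinuousOn (fun w : ℂ => p w.re + w.im * ν) (Icc a b ×ℂ Icc c d) :=
    hpre.add (by fun_prop)
  have hG : ContinuousOn (fun w : ℂ => fderiv ℝ F (p w.re + w.im * ν)) (Icc a b ×ℂ Icc c d) :=
    hdF.comp hΦ fun w hw => hmem _ hw.1 _ hw.2
  have hpt : ∀ s y : ℝ, ((s : ℂ) + y * Complex.I).re = s ∧ ((s : ℂ) + y * Complex.I).im = y := by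
    intro s y; simp
  have hc1 : ContinuousOn (fun w : ℂ => fderiv ℝ F (p w.re + w.im * ν) ν * p' w.re)
      (Icc a b ×ℂ Icc c d) := (hG.clm_apply continuousOn_const).mul hp're
  have hc2 : ContinuousOn (fun w : ℂ => ν * fderiv ℝ F (p w.re + w.im * ν) (p' w.re))
      (Icc a b ×ℂ Icc c d) := continuousOn_const.mul (hG.clm_apply hp're)
  have hcompact : IsCompact (Icc a b ×ℂ Icc c d) := isCompact_Icc.reProdIm isCompact_Icc
  have hsub : Ioc a b ×ℂ Ioc c d ⊆ Icc a b ×ℂ Icc c d := fun w hw =>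
    ⟨Ioc_subset_Icc_self hw.1, Ioc_subset_Icc_self hw.2⟩
  -- Up to the factor `I`, the area integrand is the difference of `∂/∂s (ν F)` and `∂/∂y (F p')`,
  -- each integrated along its own lines. Since the arc is swept by translation, `p'` does not
  -- depend on `y` and is never differentiated, so a `C¹` arc suffices.
  have hline1 : ∀ s ∈ Icc a b,
      ∫ y in c..d, fderiv ℝ F (p s + y * ν) ν * p' s = - (F (p s + c * ν) * p' s) := by
    intro s hs
    have hder : ∀ y ∈ uIcc c d, HasDerivAt (fun y : ℝ => F (p s + y * ν) * p' s)
        (fderiv ℝ F (p s + y * ν) ν * p' s) y := by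
      intro y hy
      rw [uIcc_of_le hcd] at hy
      have h1 : HasDerivAt (fun y : ℝ => p s + y * ν) ν y := by
        simpa using ((Complex.ofRealCLM.hasDerivAt (x := y)).mul_const ν).const_add (p s)
      exact ((hFd _ (hmem s hs y hy)).comp_hasDerivAt y h1).mul_const _
    rw [intervalIntegral.integral_eq_sub_of_hasDerivAt hder, hd s hs]
    · simp
    · refine ContinuousOn.intervalIntegrable ?_
      rw [uIcc_of_le hcd]
      refine (hc1.comp (f := fun y : ℝ => (s : ℂ) + y * Complex.I) (by fun_prop) ?_).congr ?_
      · intro y hy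
        simpa [Complex.mem_reProdIm] using ⟨hs, hy⟩
      · intro y hy
        simp
  have hline2 : ∀ y ∈ Icc c d,
      ∫ s in a..b, ν * fderiv ℝ F (p s + y * ν) (p' s) = 0 := by
    intro y hy
    have hder : ∀ s ∈ uIcc a b, HasDerivAt (fun s : ℝ => ν * F (p s + y * ν))
        (ν * fderiv ℝ F (p s + y * ν) (p' s)) s := by
      intro s hs
      rw [uIcc_of_le hab] at hs
      have h1 : HasDerivAt (fun s : ℝ => p s + y * ν) (p' s) s := (hp s hs).add_const _
      exact ((hFd _ (hmem s hs y hy)).comp_hasDerivAt s h1).const_mul _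
    rw [intervalIntegral.integral_eq_sub_of_hasDerivAt hder, ha y hy, hb y hy]
    · simp
    · refine ContinuousOn.intervalIntegrable ?_
      rw [uIcc_of_le hab]
      refine (hc2.comp (f := fun s : ℝ => (s : ℂ) + y * Complex.I) (by fun_prop) ?_).congr ?_
      · intro s hs
        simpa [Complex.mem_reProdIm] using ⟨hs, hy⟩
      · intro s hs
        simp
  have hI1 : ∫ w in Ioc a b ×ℂ Ioc c d, fderiv ℝ F (p w.re + w.im * ν) ν * p' w.re =
      - ∫ s in a..b, F (p s + c * ν) * p' s := by
    rw [setIntegral_reProdIm_Ioc hab hcd hc1, ← intervalIntegral.integral_neg]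
    refine intervalIntegral.integral_congr fun s hs => ?_
    rw [uIcc_of_le hab] at hs
    simpa [hpt] using hline1 s hs
  have hI2 : ∫ w in Ioc a b ×ℂ Ioc c d, ν * fderiv ℝ F (p w.re + w.im * ν) (p' w.re) = 0 := by
    rw [setIntegral_reProdIm_Ioc hab hcd hc2,
      MeasureTheory.intervalIntegral_intervalIntegral_swap]
    · rw [intervalIntegral.integral_congr (g := fun _ => (0 : ℂ)), intervalIntegral.integral_zero]
      intro y hy
      rw [uIcc_of_le hcd] at hy
      simpa [hpt] using hline2 y hy
    · rw [uIoc_of_le hab, uIoc_of_le hcd]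
      have : ContinuousOn (Function.uncurry fun s y : ℝ => ν * fderiv ℝ F
          (p ((s : ℂ) + y * Complex.I).re + ((s : ℂ) + y * Complex.I).im * ν)
          (p' ((s : ℂ) + y * Complex.I).re)) (Icc a b ×ˢ Icc c d) := by
        refine hc2.comp (f := fun q : ℝ × ℝ => (q.1 : ℂ) + q.2 * Complex.I) (by fun_prop) ?_
        rintro ⟨x, y⟩ ⟨hx, hy⟩
        simpa [Complex.mem_reProdIm] using ⟨hx, hy⟩
      exact (this.integrableOn_compact (isCompact_Icc.prod isCompact_Icc)).mono_set
        (prod_mono Ioc_subset_Icc_self Ioc_subset_Icc_self)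
  have hint1 := (hc1.integrableOn_compact (μ := MeasureTheory.volume) hcompact).mono_set hsub
  have hint2 := (hc2.integrableOn_compact (μ := MeasureTheory.volume) hcompact).mono_set hsub
  have key : ∫ w in Ioc a b ×ℂ Ioc c d, (ν * fderiv ℝ F (p w.re + w.im * ν) (p' w.re) -
      fderiv ℝ F (p w.re + w.im * ν) ν * p' w.re) = ∫ s in a..b, F (p s + c * ν) * p' s := by
    rw [MeasureTheory.integral_sub hint2 hint1, hI1, hI2]
    ring
  rw [← key, ← MeasureTheory.integral_const_mul]
  congr 1
  ext w
  rw [realLinearMap_apply_mul, twoDbar]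
  ring

/-- Green's formula in a curvilinear rectangle swept out by translating an arc, for a test function
times a holomorphic function that is merely continuous on the arc. -/
theorem integral_mul_eq_setIntegral_twoDbar {p p' : ℝ → ℂ} {ν : ℂ} {a b d : ℝ} (hab : a ≤ b)
    (hd0 : 0 < d) (hp : ∀ s ∈ Icc a b, HasDerivAt p (p' s) s) (hp' : ContinuousOn p' (Icc a b))
    {U : Set ℂ} (hU : IsOpen U) {φ u : ℂ → ℂ} (hφ : ContDiff ℝ 1 φ)
    (hu : DifferentiableOn ℂ u U)
    (hmem : ∀ s ∈ Icc a b, ∀ y ∈ Ioc 0 d, p s + y * ν ∈ U)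
    (huc : ContinuousOn u (closure U))
    (ha : ∀ y ∈ Icc 0 d, φ (p a + y * ν) = 0) (hb : ∀ y ∈ Icc 0 d, φ (p b + y * ν) = 0)
    (hd : ∀ s ∈ Icc a b, φ (p s + d * ν) = 0) :
    ∫ s in a..b, φ (p s) * u (p s) * p' s =
      Complex.I * ∫ w in Ioc a b ×ℂ Ioc 0 d, twoDbar φ (p w.re + w.im * ν) *
        u (p w.re + w.im * ν) *
        (((p' w.re).re * ν.im - (p' w.re).im * ν.re : ℝ) : ℂ) := by
  have hpc : ContinuousOn p (Icc a b) := fun s hs => (hp s hs).continuousAt.continuousWithinAt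
  have hre : MapsTo Complex.re (Icc a b ×ℂ Icc 0 d) (Icc a b) := fun w hw => hw.1
  have hpre : ContinuousOn (fun w : ℂ => p w.re) (Icc a b ×ℂ Icc 0 d) :=
    hpc.comp Complex.continuous_re.continuousOn hre
  have hp're : ContinuousOn (fun w : ℂ => p' w.re) (Icc a b ×ℂ Icc 0 d) :=
    hp'.comp Complex.continuous_re.continuousOn hre
  have hΦ : ContinuousOn (fun w : ℂ => p w.re + w.im * ν) (Icc a b ×ℂ Icc 0 d) :=
    hpre.add (by fun_prop)
  have hcompact : IsCompact (Icc a b ×ℂ Icc 0 d) := isCompact_Icc.reProdIm isCompact_Icc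
  have hcl : ∀ s ∈ Icc a b, ∀ y ∈ Icc 0 d, p s + y * ν ∈ closure U := by
    intro s hs y hy
    rcases hy.1.eq_or_lt with rfl | hy0
    · have ht : Tendsto (fun y : ℝ => p s + y * ν) (𝓝[>] 0) (𝓝 (p s + (0 : ℝ) * ν)) :=
        (Continuous.tendsto (by fun_prop) 0).mono_left nhdsWithin_le_nhds
      refine mem_closure_of_tendsto ht ?_
      filter_upwards [Ioc_mem_nhdsGT hd0] with y hy using hmem s hs y hy
    · exact subset_closure (hmem s hs y ⟨hy0, hy.2⟩)
  have hFc : ContinuousOn (fun w : ℂ => φ (p w.re + w.im * ν) * u (p w.re + w.im * ν) * p' w.re)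
      (Icc a b ×ℂ Icc 0 d) :=
    ((hφ.continuous.comp_continuousOn hΦ).mul
      (huc.comp hΦ fun w hw => hcl _ hw.1 _ hw.2)).mul hp're
  set H : ℂ → ℂ := fun w => twoDbar φ (p w.re + w.im * ν) * u (p w.re + w.im * ν) *
        (((p' w.re).re * ν.im - (p' w.re).im * ν.re : ℝ) : ℂ) with hH
  have hHc : ContinuousOn H (Icc a b ×ℂ Icc 0 d) := by
    refine ((hφ.continuous_twoDbar.comp_continuousOn hΦ).mul
      (huc.comp hΦ fun w hw => hcl _ hw.1 _ hw.2)).mul ?_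
    refine Complex.continuous_ofReal.comp_continuousOn ?_
    exact ((Complex.continuous_re.comp_continuousOn hp're).mul continuousOn_const).sub
      ((Complex.continuous_im.comp_continuousOn hp're).mul continuousOn_const)
  have hHi : MeasureTheory.IntegrableOn H (Ioc a b ×ℂ Ioc 0 d) :=
    (hHc.integrableOn_compact (μ := MeasureTheory.volume) hcompact).mono_set fun w hw =>
      ⟨Ioc_subset_Icc_self hw.1, Ioc_subset_Icc_self hw.2⟩
  obtain ⟨C, hC⟩ := hcompact.exists_bound_of_continuousOn hFc
  -- the formula on the part of the rectangle above a positive height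
  have hδ : ∀ δ ∈ Ioc 0 d, ∫ s in a..b, φ (p s + δ * ν) * u (p s + δ * ν) * p' s =
      Complex.I * ∫ w in Ioc a b ×ℂ Ioc δ d, H w := by
    intro δ hδ
    have hsub : ∀ y ∈ Icc δ d, y ∈ Ioc 0 d := fun y hy => ⟨hδ.1.trans_le hy.1, hy.2⟩
    rw [integral_eq_setIntegral_twoDbar (F := fun z => φ z * u z) hab hδ.2 hp hp' hU
      (hφ.contDiffOn.mul ((hu.contDiffOn hU).restrict_scalars ℝ))
      (fun s hs y hy => hmem s hs y (hsub y hy))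
      (fun y hy => by simp [ha y (Ioc_subset_Icc_self (hsub y hy))])
      (fun y hy => by simp [hb y (Ioc_subset_Icc_self (hsub y hy))])
      (fun s hs => by simp [hd s hs])]
    congr 1
    refine MeasureTheory.setIntegral_congr_fun
      (measurableSet_Ioc.reProdIm measurableSet_Ioc) fun w hw => ?_
    simp only [hH]
    rw [twoDbar_mul_of_differentiableAt (hφ.differentiable one_ne_zero _)
      (hu.differentiableAt (hU.mem_nhds
        (hmem _ (Ioc_subset_Icc_self hw.1) _ (hsub _ (Ioc_subset_Icc_self hw.2)))))]
  -- As `u` is only continuous on the arc itself, the heights descend to `0`: the arc integrals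
  -- converge by domination, the area integrals because the rectangles increase to the full one.
  set δ : ℕ → ℝ := fun n => d / (n + 1) with hδdef
  have hδmem : ∀ n, δ n ∈ Ioc 0 d := fun n =>
    ⟨by positivity, div_le_self hd0.le (by linarith [n.cast_nonneg (α := ℝ)])⟩
  have hδ0 : Tendsto δ atTop (𝓝 0) := by
    simpa [hδdef, div_eq_mul_inv] using
      (tendsto_one_div_add_atTop_nhds_zero_nat (𝕜 := ℝ)).const_mul d
  have hanti : Antitone δ := fun m n hmn => by
    have : (m : ℝ) ≤ n := by exact_mod_cast hmn
    simp only [hδdef]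
    gcongr
  have hL : Tendsto (fun n => ∫ s in a..b, φ (p s + δ n * ν) * u (p s + δ n * ν) * p' s) atTop
      (𝓝 (∫ s in a..b, φ (p s) * u (p s) * p' s)) := by
    refine intervalIntegral.tendsto_integral_filter_of_dominated_convergence (fun _ => C) ?_ ?_
      (by simp) ?_
    · refine Eventually.of_forall fun n => ?_
      rw [uIoc_of_le hab]
      refine ContinuousOn.aestronglyMeasurable ?_ measurableSet_Ioc
      refine (hFc.comp (f := fun s : ℝ => (s : ℂ) + δ n * Complex.I) (by fun_prop) ?_).congr ?_
      · intro s hs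
        simpa [Complex.mem_reProdIm] using
          ⟨Ioc_subset_Icc_self hs, Ioc_subset_Icc_self (hδmem n)⟩
      · intro s hs
        simp
    · refine Eventually.of_forall fun n => Eventually.of_forall fun s hs => ?_
      rw [uIoc_of_le hab] at hs
      simpa using hC ((s : ℂ) + δ n * Complex.I) (by
        simpa [Complex.mem_reProdIm] using
          ⟨Ioc_subset_Icc_self hs, Ioc_subset_Icc_self (hδmem n)⟩)
    · refine Eventually.of_forall fun s hs => ?_
      rw [uIoc_of_le hab] at hs
      have hs' := Ioc_subset_Icc_self hs
      have hcont : ContinuousOn (fun y : ℝ => φ (p s + y * ν) * u (p s + y * ν) * p' s)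
          (Icc 0 d) := by
        refine (hFc.comp (f := fun y : ℝ => (s : ℂ) + y * Complex.I) (by fun_prop) ?_).congr ?_
        · intro y hy
          simpa [Complex.mem_reProdIm] using ⟨hs', hy⟩
        · intro y hy
          simp
      have := (hcont 0 (left_mem_Icc.2 hd0.le)).tendsto.comp
        (tendsto_nhdsWithin_iff.2 ⟨hδ0, Eventually.of_forall fun n =>
          Ioc_subset_Icc_self (hδmem n)⟩)
      simpa [Function.comp_def] using this
  have hUn : ⋃ n, Ioc a b ×ℂ Ioc (δ n) d = Ioc a b ×ℂ Ioc 0 d := by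
    ext w
    simp only [mem_iUnion, Complex.mem_reProdIm]
    constructor
    · rintro ⟨n, h1, h2⟩
      exact ⟨h1, (hδmem n).1.trans h2.1, h2.2⟩
    · rintro ⟨h1, h2⟩
      obtain ⟨n, hn⟩ := (hδ0.eventually (gt_mem_nhds h2.1)).exists
      exact ⟨n, h1, hn, h2.2⟩
  have hR : Tendsto (fun n => Complex.I * ∫ w in Ioc a b ×ℂ Ioc (δ n) d, H w) atTop
      (𝓝 (Complex.I * ∫ w in Ioc a b ×ℂ Ioc 0 d, H w)) := by
    refine Tendsto.const_mul _ ?_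
    rw [← hUn]
    refine MeasureTheory.tendsto_setIntegral_of_monotone
      (fun n => measurableSet_Ioc.reProdIm measurableSet_Ioc) ?_ (by rwa [hUn])
    intro m n hmn w hw
    exact ⟨hw.1, (hanti hmn).trans_lt hw.2.1, hw.2.2⟩
  exact tendsto_nhds_unique (hL.congr fun n => hδ _ (hδmem n)) hR

/-! ### Coordinates straightening the arc -/

/-- The map `s + i y ↦ p s + y ν` sweeping out the translates of the arc `p` along `ν`. -/
noncomputable def arcSweep (p : ℝ → ℂ) (ν : ℂ) (w : ℂ) : ℂ := p w.re + w.im * ν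

/-- The real derivative of `arcSweep p ν` at a point of abscissa `s`, where `v = p' s`. -/
noncomputable def arcSweepDeriv (v ν : ℂ) : ℂ →L[ℝ] ℂ :=
  Complex.reCLM.smulRight v + Complex.imCLM.smulRight ν

theorem arcSweepDeriv_det (v ν : ℂ) :
    (arcSweepDeriv v ν).det = v.re * ν.im - v.im * ν.re := by
  rw [ContinuousLinearMap.det, ← LinearMap.det_toMatrix Complex.basisOneI, Matrix.det_fin_two]
  simp [LinearMap.toMatrix_apply, arcSweepDeriv]
  ring

theorem arcSweep_ofReal (p : ℝ → ℂ) (ν : ℂ) (s : ℝ) : arcSweep p ν s = p s := by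
  simp [arcSweep]

namespace IsSmoothCrosscut

variable {p : ℝ → ℂ}

theorem hasDerivAt (hp : IsSmoothCrosscut p) {s : ℝ} (hs : s ∈ Ioo (0 : ℝ) 1) :
    HasDerivAt p (deriv p s) s :=
  ((hp.contDiffOn.differentiableOn one_ne_zero).differentiableAt
    (isOpen_Ioo.mem_nhds hs)).hasDerivAt

theorem continuousOn_deriv (hp : IsSmoothCrosscut p) : ContinuousOn (deriv p) (Ioo 0 1) :=
  hp.contDiffOn.continuousOn_deriv_of_isOpen isOpen_Ioo le_rfl

theorem contDiffAt_arcSweep (hp : IsSmoothCrosscut p) (ν : ℂ) {w : ℂ} (hw : w.re ∈ Ioo (0 : ℝ) 1) :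
    ContDiffAt ℝ 1 (arcSweep p ν) w := by
  have h1 : ContDiffAt ℝ 1 p w.re := hp.contDiffOn.contDiffAt (isOpen_Ioo.mem_nhds hw)
  have h2 : ContDiffAt ℝ 1 (fun w : ℂ => p w.re) w :=
    h1.comp (f := fun w : ℂ => w.re) w Complex.reCLM.contDiff.contDiffAt
  have h3 : ContDiff ℝ 1 (fun w : ℂ => (w.im : ℂ)) :=
    (Complex.ofRealCLM.comp Complex.imCLM).contDiff
  exact h2.add (h3.contDiffAt.mul contDiffAt_const)

theorem hasFDerivAt_arcSweep (hp : IsSmoothCrosscut p) (ν : ℂ) {w : ℂ}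
    (hw : w.re ∈ Ioo (0 : ℝ) 1) :
    HasFDerivAt (arcSweep p ν) (arcSweepDeriv (deriv p w.re) ν) w := by
  have h2 : HasFDerivAt (fun w : ℂ => p w.re) (Complex.reCLM.smulRight (deriv p w.re)) w := by
    refine ((hp.hasDerivAt hw).hasFDerivAt.comp w Complex.reCLM.hasFDerivAt).congr_fderiv ?_
    ext; simp
  have h3 : HasFDerivAt (fun w : ℂ => (w.im : ℂ) * ν) (Complex.imCLM.smulRight ν) w := by
    refine (Complex.imCLM.smulRight ν).hasFDerivAt.congr_of_eventuallyEq
      (Eventually.of_forall fun w => ?_)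
    simp
  exact h2.add h3

/-- Coordinates straightening a crosscut near an interior point. -/
theorem exists_box (hp : IsSmoothCrosscut p) {s₀ : ℝ} (hs₀ : s₀ ∈ Ioo (0 : ℝ) 1) :
    ∃ η > 0, Icc (s₀ - η) (s₀ + η) ⊆ Ioo 0 1 ∧
      InjOn (arcSweep p (Complex.I * deriv p s₀)) (Icc (s₀ - η) (s₀ + η) ×ℂ Icc (-η) η) ∧
      IsOpen (arcSweep p (Complex.I * deriv p s₀) ''
        (Ioo (s₀ - η) (s₀ + η) ×ℂ Ioo (-η) η)) ∧
      MapsTo (arcSweep p (Complex.I * deriv p s₀)) (Icc (s₀ - η) (s₀ + η) ×ℂ Icc (-η) η)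
        (ball 0 1) ∧
      (∀ s ∈ Icc (s₀ - η) (s₀ + η),
        0 < (arcSweepDeriv (deriv p s) (Complex.I * deriv p s₀)).det) ∧
      ∀ w ∈ Icc (s₀ - η) (s₀ + η) ×ℂ Icc (-η) η, ∀ s ∈ Ioo (0 : ℝ) 1,
        p s = arcSweep p (Complex.I * deriv p s₀) w → w = s := by
  set ν := Complex.I * deriv p s₀ with hν
  set Φ := arcSweep p ν
  -- For `ν = I * p' s₀` the Jacobian at `s₀` is `|p' s₀| ^ 2`.
  have hdet : 0 < (arcSweepDeriv (deriv p s₀) ν).det := by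
    rw [arcSweepDeriv_det]
    have h1 : 0 < Complex.normSq (deriv p s₀) :=
      Complex.normSq_pos.2 (hp.deriv_ne_zero s₀ hs₀)
    rw [Complex.normSq_apply] at h1
    simpa [hν] using h1
  have hs₀' : (s₀ : ℂ).re ∈ Ioo (0 : ℝ) 1 := by simpa using hs₀
  have hcd := hp.contDiffAt_arcSweep ν hs₀'
  have hfd : HasFDerivAt Φ (((arcSweepDeriv (deriv p s₀) ν).toContinuousLinearEquivOfDetNeZero
      hdet.ne' : ℂ ≃L[ℝ] ℂ) : ℂ →L[ℝ] ℂ) (s₀ : ℂ) := by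
    simpa using hp.hasFDerivAt_arcSweep ν hs₀'
  set E := hcd.toOpenPartialHomeomorph Φ hfd one_ne_zero with hE
  have hEΦ : (E : ℂ → ℂ) = Φ := rfl
  have hmem : (s₀ : ℂ) ∈ E.source := hcd.mem_toOpenPartialHomeomorph_source hfd one_ne_zero
  have hΦs₀ : Φ s₀ = p s₀ := arcSweep_ofReal _ _ _
  have hcont : ContinuousAt Φ (s₀ : ℂ) := hfd.continuousAt
  -- far parts of the arc stay away from `p s₀`
  set W : Set ℝ := {s | (s : ℂ) ∈ E.source}
  have hWo : IsOpen W := E.open_source.preimage Complex.continuous_ofReal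
  have hKc : IsCompact (p '' (Icc 0 1 \ W)) :=
    (isCompact_Icc.diff hWo).image_of_continuousOn (hp.continuousOn.mono sdiff_subset)
  have hnot : p s₀ ∉ p '' (Icc 0 1 \ W) := by
    rintro ⟨s, ⟨hs, hsW⟩, hps⟩
    have hlt : ‖p s₀‖ < 1 := by simpa using hp.mapsTo hs₀
    rcases eq_or_lt_of_le hs.1 with rfl | h0
    · rw [← hps, hp.norm_left] at hlt; exact lt_irrefl _ hlt
    rcases eq_or_lt_of_le hs.2 with rfl | h1
    · rw [← hps, hp.norm_right] at hlt; exact lt_irrefl _ hlt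
    · exact hsW (by rw [hp.injOn ⟨h0, h1⟩ hs₀ hps]; exact hmem)
  have hre : ContinuousAt Complex.re (s₀ : ℂ) := Complex.continuous_re.continuousAt
  have hV1 : ∀ᶠ w : ℂ in 𝓝 (s₀ : ℂ), w.re ∈ Ioo (0 : ℝ) 1 :=
    hre.eventually (isOpen_Ioo.mem_nhds hs₀')
  have hV2 : ∀ᶠ w : ℂ in 𝓝 (s₀ : ℂ), 0 < (arcSweepDeriv (deriv p w.re) ν).det := by
    have hd : ContinuousAt (deriv p) (s₀ : ℂ).re :=
      hp.continuousOn_deriv.continuousAt (isOpen_Ioo.mem_nhds hs₀')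
    have hd2 : ContinuousAt (fun w : ℂ => deriv p w.re) (s₀ : ℂ) := hd.comp hre
    have : ContinuousAt (fun w : ℂ => (arcSweepDeriv (deriv p w.re) ν).det) (s₀ : ℂ) := by
      simp_rw [arcSweepDeriv_det]
      exact ((Complex.continuous_re.continuousAt.comp hd2).mul continuousAt_const).sub
        ((Complex.continuous_im.continuousAt.comp hd2).mul continuousAt_const)
    exact this.eventually (lt_mem_nhds (by simpa using hdet))
  have hV3 : ∀ᶠ w : ℂ in 𝓝 (s₀ : ℂ), Φ w ∈ ball (0 : ℂ) 1 :=
    hcont.eventually (isOpen_ball.mem_nhds (by rw [hΦs₀]; exact hp.mapsTo hs₀))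
  have hV4 : ∀ᶠ w : ℂ in 𝓝 (s₀ : ℂ), Φ w ∈ (p '' (Icc 0 1 \ W))ᶜ :=
    hcont.eventually (hKc.isClosed.isOpen_compl.mem_nhds (by rw [hΦs₀]; exact hnot))
  have hV5 : ∀ᶠ w : ℂ in 𝓝 (s₀ : ℂ), w ∈ E.source := E.open_source.mem_nhds hmem
  obtain ⟨r, hr, hball⟩ := Metric.eventually_nhds_iff.1
    (hV1.and (hV2.and (hV3.and (hV4.and hV5))))
  -- Half-side `r / 3` suffices because `|re| + |im| ≤ 2 r / 3 < r`.
  have hbox : ∀ w ∈ Icc (s₀ - r / 3) (s₀ + r / 3) ×ℂ Icc (-(r / 3)) (r / 3),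
      dist w (s₀ : ℂ) < r := by
    rintro w ⟨h1, h2⟩
    simp only [mem_preimage, mem_Icc] at h1 h2
    rw [dist_eq_norm]
    refine (Complex.norm_le_abs_re_add_abs_im _).trans_lt ?_
    have e1 : |(w - s₀ : ℂ).re| ≤ r / 3 := by
      rw [abs_le]; simp; constructor <;> linarith [h1.1, h1.2]
    have e2 : |(w - s₀ : ℂ).im| ≤ r / 3 := by
      rw [abs_le]; simp; exact ⟨by linarith [h2.1], h2.2⟩
    linarith
  have hreal : ∀ s ∈ Icc (s₀ - r / 3) (s₀ + r / 3),
      (s : ℂ) ∈ Icc (s₀ - r / 3) (s₀ + r / 3) ×ℂ Icc (-(r / 3)) (r / 3) := by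
    intro s hs
    exact ⟨by simpa using hs, by simp; linarith⟩
  refine ⟨r / 3, by positivity, ?_, ?_, ?_, ?_, ?_, ?_⟩
  · intro s hs
    simpa using (hball (hbox _ (hreal s hs))).1
  · exact E.injOn.mono fun w hw => (hball (hbox w hw)).2.2.2.2
  · refine E.isOpen_image_of_subset_source (isOpen_Ioo.reProdIm isOpen_Ioo) fun w hw => ?_
    exact (hball (hbox w ⟨Ioo_subset_Icc_self hw.1, Ioo_subset_Icc_self hw.2⟩)).2.2.2.2
  · exact fun w hw => (hball (hbox w hw)).2.2.1
  · intro s hs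
    simpa using (hball (hbox _ (hreal s hs))).2.1
  · intro w hw s hs hpw
    have hsW : s ∈ W := by
      by_contra h
      exact (hball (hbox w hw)).2.2.2.1 ⟨s, ⟨Ioo_subset_Icc_self hs, h⟩, hpw⟩
    refine E.injOn (hball (hbox w hw)).2.2.2.2 hsW ?_
    rw [hEΦ, ← hpw]
    exact (arcSweep_ofReal _ _ _).symm

end IsSmoothCrosscut

/-! ### The two sides of the arc -/

/-- Each half of the box is convex in the straightened coordinates, so its image is connected; it
misses the arc, hence lies in a single one of the two domains. The orientation decides the upper
half, since `s₀ + ε I` goes to `p s₀ + ε I p' s₀`. The lower half cannot be decided locally. -/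
theorem IsLune.exists_box_aux {p : ℝ → ℂ} {D D' : Set ℂ} (hD : IsLune p D) (hD' : IsPlaneDomain D')
    (hdisj : Disjoint D D') (hun : D ∪ D' = ball 0 1 \ arcTrace p) {s₀ : ℝ}
    (hs₀ : s₀ ∈ Ioo (0 : ℝ) 1) :
    ∃ η > 0, Icc (s₀ - η) (s₀ + η) ⊆ Ioo 0 1 ∧
      InjOn (arcSweep p (Complex.I * deriv p s₀)) (Icc (s₀ - η) (s₀ + η) ×ℂ Icc (-η) η) ∧
      IsOpen (arcSweep p (Complex.I * deriv p s₀) ''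
        (Ioo (s₀ - η) (s₀ + η) ×ℂ Ioo (-η) η)) ∧
      (∀ s ∈ Icc (s₀ - η) (s₀ + η),
        0 < (arcSweepDeriv (deriv p s) (Complex.I * deriv p s₀)).det) ∧
      (∀ w ∈ Icc (s₀ - η) (s₀ + η) ×ℂ Icc (-η) η, ∀ s ∈ Ioo (0 : ℝ) 1,
        p s = arcSweep p (Complex.I * deriv p s₀) w → w = s) ∧
      MapsTo (arcSweep p (Complex.I * deriv p s₀)) (Icc (s₀ - η) (s₀ + η) ×ℂ Ioc 0 η) D ∧
      (MapsTo (arcSweep p (Complex.I * deriv p s₀)) (Icc (s₀ - η) (s₀ + η) ×ℂ Ico (-η) 0) D ∨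
      MapsTo (arcSweep p (Complex.I * deriv p s₀)) (Icc (s₀ - η) (s₀ + η) ×ℂ Ico (-η) 0) D') := by
  have hp := hD.isSmoothCrosscut
  obtain ⟨η, hη, h1, hinj, hopen, hmaps, hdet, huniq⟩ := hp.exists_box hs₀
  refine ⟨η, hη, h1, hinj, hopen, hdet, huniq, ?_⟩
  set Φ := arcSweep p (Complex.I * deriv p s₀)
  have hside : ∀ T : Set ℝ, T.OrdConnected → T ⊆ Icc (-η) η → 0 ∉ T →
      MapsTo Φ (Icc (s₀ - η) (s₀ + η) ×ℂ T) D ∨ MapsTo Φ (Icc (s₀ - η) (s₀ + η) ×ℂ T) D' := by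
    intro T hT hTη hT0
    have hconv : Convex ℝ (Icc (s₀ - η) (s₀ + η) ×ℂ T) :=
      ((convex_Icc _ _).linear_preimage Complex.reLm).inter
        (hT.convex.linear_preimage Complex.imLm)
    have hpre : IsPreconnected (Φ '' (Icc (s₀ - η) (s₀ + η) ×ℂ T)) :=
      hconv.isPreconnected.image _ fun w hw =>
        (hp.contDiffAt_arcSweep _ (h1 hw.1)).continuousAt.continuousWithinAt
    have hsub : Φ '' (Icc (s₀ - η) (s₀ + η) ×ℂ T) ⊆ D ∪ D' := by
      rintro _ ⟨w, hw, rfl⟩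
      rw [hun]
      refine ⟨hmaps ⟨hw.1, hTη hw.2⟩, ?_⟩
      rintro ⟨s, hs, hsw⟩
      have := huniq w ⟨hw.1, hTη hw.2⟩ s hs hsw
      exact hT0 (by simpa [this] using hw.2)
    rcases hpre.subset_or_subset hD.isPlaneDomain.1 hD'.1 hdisj hsub with h | h
    · exact Or.inl (mapsTo_iff_image_subset.2 h)
    · exact Or.inr (mapsTo_iff_image_subset.2 h)
  refine ⟨?_, hside _ ordConnected_Ico (fun y hy => ⟨hy.1, by linarith [hy.2]⟩) (by simp)⟩
  refine (hside _ ordConnected_Ioc (fun y hy => ⟨by linarith [hy.1], hy.2⟩)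
    (by simp)).resolve_right fun h => ?_
  obtain ⟨ε, hε, hε'⟩ := ((hD.left_side s₀ hs₀).and (Ioc_mem_nhdsGT hη)).exists
  have h2 : (s₀ + ε * Complex.I : ℂ) ∈ Icc (s₀ - η) (s₀ + η) ×ℂ Ioc 0 η := by
    refine ⟨?_, by simpa using hε'⟩
    simp [hη.le]
  have h3 := h h2
  simp only [Φ, arcSweep] at h3
  exact hdisj.le_bot ⟨hε, by simpa using h3⟩

/-- By the dichotomy for the lower half box, adherence of `p s` to `D'` is locally constant in `s`,
hence constant on the connected interval. If it failed everywhere, `D'` would be both open and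
relatively closed in the disk, against connectedness of the disk. -/
theorem IsLune.mem_closure_other_side {p : ℝ → ℂ} {D D' : Set ℂ} (hD : IsLune p D)
    (hD' : IsPlaneDomain D') (hdisj : Disjoint D D') (hun : D ∪ D' = ball 0 1 \ arcTrace p) {s : ℝ}
    (hs : s ∈ Ioo (0 : ℝ) 1) : p s ∈ closure D' := by
  have hp := hD.isSmoothCrosscut
  have hcover : Ioo (0 : ℝ) 1 ⊆
      interior {s | p s ∈ closure D'} ∪ interior {s | p s ∉ closure D'} := by
    intro s₀ hs₀
    obtain ⟨η, hη, h1, hinj, hopen, hdet, huniq, hup, hlow⟩ :=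
      hD.exists_box_aux hD' hdisj hun hs₀
    have hnhds : Ioo (s₀ - η) (s₀ + η) ∈ 𝓝 s₀ := Ioo_mem_nhds (by linarith) (by linarith)
    rcases hlow with hlow | hlow
    · right
      rw [mem_interior_iff_mem_nhds]
      filter_upwards [hnhds] with s hs hcl
      have hpo : p s ∈ arcSweep p (Complex.I * deriv p s₀) ''
          (Ioo (s₀ - η) (s₀ + η) ×ℂ Ioo (-η) η) :=
        ⟨s, ⟨by simpa using hs, by simpa using hη⟩, arcSweep_ofReal _ _ _⟩
      obtain ⟨_, ⟨w, hw, rfl⟩, hwD'⟩ := mem_closure_iff.1 hcl _ hopen hpo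
      rcases lt_trichotomy w.im 0 with h | h | h
      · exact hdisj.le_bot ⟨hlow ⟨Ioo_subset_Icc_self hw.1, hw.2.1.le, h⟩, hwD'⟩
      · have : arcSweep p (Complex.I * deriv p s₀) w ∈ ball 0 1 \ arcTrace p :=
          hun ▸ Or.inr hwD'
        exact this.2 ⟨w.re, h1 (Ioo_subset_Icc_self hw.1), by simp [arcSweep, h]⟩
      · exact hdisj.le_bot ⟨hup ⟨Ioo_subset_Icc_self hw.1, h, hw.2.2.le⟩, hwD'⟩
    · left
      rw [mem_interior_iff_mem_nhds]
      filter_upwards [hnhds] with s hs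
      have ht : Tendsto (fun y : ℝ => arcSweep p (Complex.I * deriv p s₀) (s + y * Complex.I))
          (𝓝[<] 0) (𝓝 (p s)) := by
        have : Continuous (fun y : ℝ =>
            arcSweep p (Complex.I * deriv p s₀) (s + y * Complex.I)) := by
          simp only [arcSweep]; simp; fun_prop
        simpa [arcSweep] using (this.tendsto 0).mono_left nhdsWithin_le_nhds
      refine mem_closure_of_tendsto ht ?_
      filter_upwards [Ico_mem_nhdsLT (neg_lt_zero.2 hη)] with y hy
      refine hlow ⟨?_, by simpa using hy⟩
      simpa using Ioo_subset_Icc_self hs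
  rcases isPreconnected_Ioo.subset_or_subset isOpen_interior isOpen_interior
    (disjoint_left.2 fun x hx hx' =>
      (interior_subset hx' : x ∈ {s | p s ∉ closure D'})
        (interior_subset hx : x ∈ {s | p s ∈ closure D'})) hcover with h | h
  · exact (interior_subset (h hs) : s ∈ {s | p s ∈ closure D'})
  · exfalso
    have hcov : ball (0 : ℂ) 1 ⊆ (closure D')ᶜ ∪ D' := by
      intro z hz
      by_cases hzΓ : z ∈ arcTrace p
      · obtain ⟨s, hs, rfl⟩ := hzΓ
        exact Or.inl (interior_subset (h hs) : s ∈ {s | p s ∉ closure D'})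
      · have : z ∈ D ∪ D' := hun ▸ ⟨hz, hzΓ⟩
        refine this.imp (fun hzD hcl => ?_) id
        obtain ⟨x, hx, hx'⟩ := mem_closure_iff.1 hcl D hD.isPlaneDomain.1 hzD
        exact hdisj.le_bot ⟨hx, hx'⟩
    have hsub : D ∪ D' ⊆ ball 0 1 := hun ▸ sdiff_subset
    obtain ⟨x, hx⟩ := hD.isPlaneDomain.2.nonempty
    obtain ⟨y, hy⟩ := hD'.2.nonempty
    rcases (convex_ball (0 : ℂ) 1).isPreconnected.subset_or_subset isClosed_closure.isOpen_compl
      hD'.1 (disjoint_left.2 fun x hx hx' => hx (subset_closure hx')) hcov with h' | h'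
    · exact h' (hsub (Or.inr hy)) (subset_closure hy)
    · exact hdisj.le_bot ⟨hx, h' (hsub (Or.inl hx))⟩

/-- Near an interior point of the arc, the lune is exactly what lies on the left of the arc. -/
theorem IsLune.exists_box {p : ℝ → ℂ} {D : Set ℂ} (hD : IsLune p D) {s₀ : ℝ}
    (hs₀ : s₀ ∈ Ioo (0 : ℝ) 1) :
    ∃ η > 0, Icc (s₀ - η) (s₀ + η) ⊆ Ioo 0 1 ∧
      InjOn (arcSweep p (Complex.I * deriv p s₀)) (Icc (s₀ - η) (s₀ + η) ×ℂ Icc (-η) η) ∧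
      IsOpen (arcSweep p (Complex.I * deriv p s₀) ''
        (Ioo (s₀ - η) (s₀ + η) ×ℂ Ioo (-η) η)) ∧
      (∀ s ∈ Icc (s₀ - η) (s₀ + η),
        0 < (arcSweepDeriv (deriv p s) (Complex.I * deriv p s₀)).det) ∧
      (∀ w ∈ Icc (s₀ - η) (s₀ + η) ×ℂ Icc (-η) η, ∀ s ∈ Ioo (0 : ℝ) 1,
        p s = arcSweep p (Complex.I * deriv p s₀) w → w = s) ∧
      ∀ w ∈ Icc (s₀ - η) (s₀ + η) ×ℂ Icc (-η) η,
        arcSweep p (Complex.I * deriv p s₀) w ∈ D ↔ 0 < w.im := by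
  obtain ⟨D', hD', hdisj, hun⟩ := hD.divides
  obtain ⟨η, hη, h1, hinj, hopen, hdet, huniq, hup, hlow⟩ :=
    hD.exists_box_aux hD' hdisj hun hs₀
  refine ⟨η, hη, h1, hinj, hopen, hdet, huniq, fun w hw => ⟨fun hwD => ?_, fun h =>
    hup ⟨hw.1, h, hw.2.2⟩⟩⟩
  have hline : ∀ w ∈ Icc (s₀ - η) (s₀ + η) ×ℂ Icc (-η) η, w.im = 0 →
      arcSweep p (Complex.I * deriv p s₀) w ∉ D ∪ D' := by
    intro w hw h hmem
    rw [hun] at hmem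
    exact hmem.2 ⟨w.re, h1 hw.1, by simp [arcSweep, h]⟩
  by_contra! h
  rcases h.eq_or_lt with h | h
  · exact hline w hw h (Or.inl hwD)
  rcases hlow with hlow | hlow
  -- If the lower half were in `D` too, the open box would be a neighbourhood of `p s₀` missing
  -- `D'`.
  · have hpo : p s₀ ∈ arcSweep p (Complex.I * deriv p s₀) ''
        (Ioo (s₀ - η) (s₀ + η) ×ℂ Ioo (-η) η) :=
      ⟨s₀, ⟨by simp [hη], by simpa using hη⟩, arcSweep_ofReal _ _ _⟩
    obtain ⟨_, ⟨x, hx, rfl⟩, hxD'⟩ := mem_closure_iff.1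
      (hD.mem_closure_other_side hD' hdisj hun hs₀) _ hopen hpo
    have hx1 := Ioo_subset_Icc_self hx.1
    rcases lt_trichotomy x.im 0 with h | h | h
    · exact hdisj.le_bot ⟨hlow ⟨hx1, hx.2.1.le, h⟩, hxD'⟩
    · exact hline x ⟨hx1, Ioo_subset_Icc_self hx.2⟩ h (Or.inr hxD')
    · exact hdisj.le_bot ⟨hup ⟨hx1, h, hx.2.2.le⟩, hxD'⟩
  · exact hdisj.le_bot ⟨hwD, hlow ⟨hw.1, hw.2.1, h⟩⟩

/-! ### Green's formula in a lune -/

theorem IsSmoothCrosscut.arcIntegrable {p : ℝ → ℂ} (hp : IsSmoothCrosscut p) {f : ℂ → ℂ}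
    (hf : ContinuousOn f (p '' Icc 0 1)) : ArcIntegrable p f := by
  obtain ⟨C, hC⟩ :=
    (isCompact_Icc.image_of_continuousOn hp.continuousOn).exists_bound_of_continuousOn hf
  have hmaps : MapsTo p (Ioo 0 1) (p '' Icc 0 1) := fun s hs =>
    mem_image_of_mem _ (Ioo_subset_Icc_self hs)
  have hint := hp.finite_length
  unfold ArcIntegrable
  rw [intervalIntegrable_iff_integrableOn_Ioo_of_le zero_le_one] at hint ⊢
  refine MeasureTheory.Integrable.bdd_mul (c := C) hint ?_ ?_
  · exact (hf.comp (hp.continuousOn.mono Ioo_subset_Icc_self) hmaps).aestronglyMeasurable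
      measurableSet_Ioo
  · exact (MeasureTheory.ae_restrict_iff' measurableSet_Ioo).2
      (Eventually.of_forall fun s hs => hC _ (hmaps hs))

namespace IsLune

variable {p : ℝ → ℂ} {D : Set ℂ}

theorem arcTrace_subset_closure (hD : IsLune p D) : arcTrace p ⊆ closure D := by
  rintro _ ⟨s, hs, rfl⟩
  have ht : Tendsto (fun ε : ℝ => p s + (ε : ℂ) * (Complex.I * deriv p s)) (𝓝[>] 0) (𝓝 (p s)) := by
    have : Continuous (fun ε : ℝ => p s + (ε : ℂ) * (Complex.I * deriv p s)) := by fun_prop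
    simpa using (this.tendsto 0).mono_left nhdsWithin_le_nhds
  exact mem_closure_of_tendsto ht (hD.left_side s hs)

theorem subset_ball (hD : IsLune p D) : D ⊆ ball 0 1 := by
  obtain ⟨D', -, -, hun⟩ := hD.divides
  exact fun z hz => (hun ▸ Or.inl hz : z ∈ ball 0 1 \ arcTrace p).1

theorem isCompact_closure (hD : IsLune p D) : IsCompact (closure D) :=
  (isBounded_ball.subset hD.subset_ball).isCompact_closure

theorem image_subset_closure (hD : IsLune p D) : p '' Icc 0 1 ⊆ closure D := by
  have h : p '' closure (Ioo 0 1) ⊆ closure (p '' Ioo 0 1) :=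
    ContinuousOn.image_closure (by
      rw [closure_Ioo zero_ne_one]; exact hD.isSmoothCrosscut.continuousOn)
  rw [closure_Ioo zero_ne_one] at h
  exact h.trans (closure_minimal hD.arcTrace_subset_closure isClosed_closure)

theorem disjoint_image (hD : IsLune p D) : Disjoint D (p '' Icc 0 1) := by
  have hp := hD.isSmoothCrosscut
  obtain ⟨D', -, -, hun⟩ := hD.divides
  rw [disjoint_left]
  rintro _ hz ⟨s, hs, rfl⟩
  have hlt : ‖p s‖ < 1 := by simpa using hD.subset_ball hz
  rcases eq_or_lt_of_le hs.1 with rfl | h0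
  · exact hlt.ne hp.norm_left
  rcases eq_or_lt_of_le hs.2 with rfl | h1
  · exact hlt.ne hp.norm_right
  · exact (hun ▸ Or.inl hz : p s ∈ ball 0 1 \ arcTrace p).2 ⟨s, ⟨h0, h1⟩, rfl⟩

theorem integrableOn (hD : IsLune p D) {f : ℂ → ℂ} (hf : ContinuousOn f (closure D)) :
    MeasureTheory.IntegrableOn f D :=
  (hf.integrableOn_compact hD.isCompact_closure).mono_set subset_closure

/-- Green's formula for test functions supported near an interior point of the arc. -/
theorem exists_green_nhds_arc (hD : IsLune p D) {s₀ : ℝ} (hs₀ : s₀ ∈ Ioo (0 : ℝ) 1) :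
    ∃ V, IsOpen V ∧ p s₀ ∈ V ∧ ∀ u φ : ℂ → ℂ, DifferentiableOn ℂ u D →
      ContinuousOn u (closure D) → ContDiff ℝ 1 φ → tsupport φ ⊆ V →
      arcIntegral p (fun ζ => φ ζ * u ζ) = Complex.I * ∫ z in D, twoDbar φ z * u z := by
  have hp := hD.isSmoothCrosscut
  obtain ⟨η, hη, h1, hinj, hopen, hdet, huniq, hside⟩ := hD.exists_box hs₀
  set ν := Complex.I * deriv p s₀ with hν
  refine ⟨_, hopen, ⟨s₀, ⟨by simp [hη], by simpa using hη⟩, arcSweep_ofReal _ _ _⟩, ?_⟩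
  intro u φ hu huc hφ hsupp
  have hab : s₀ - η ≤ s₀ + η := by linarith
  have hopcl : Ioo (s₀ - η) (s₀ + η) ×ℂ Ioo (-η) η ⊆ Icc (s₀ - η) (s₀ + η) ×ℂ Icc (-η) η :=
    fun w hw => ⟨Ioo_subset_Icc_self hw.1, Ioo_subset_Icc_self hw.2⟩
  have hhalf : Ioc (s₀ - η) (s₀ + η) ×ℂ Ioc 0 η ⊆ Icc (s₀ - η) (s₀ + η) ×ℂ Icc (-η) η :=
    fun w hw => ⟨Ioc_subset_Icc_self hw.1, by linarith [hw.2.1], hw.2.2⟩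
  -- By injectivity on the closed box, its edges are not mapped into the image of the open box,
  -- which contains the support of `φ`. So `φ` vanishes on the three sides other than the arc.
  have hzero : ∀ w ∈ Icc (s₀ - η) (s₀ + η) ×ℂ Icc (-η) η,
      w ∉ Ioo (s₀ - η) (s₀ + η) ×ℂ Ioo (-η) η → φ (arcSweep p ν w) = 0 := by
    intro w hw hwo
    by_contra h
    obtain ⟨w', hw', he⟩ := hsupp (subset_tsupport φ h)
    exact hwo (hinj (hopcl hw') hw he ▸ hw')
  have hpt : ∀ s y : ℝ, arcSweep p ν (s + y * Complex.I) = p s + y * ν := by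
    intro s y; simp [arcSweep]
  have hrect := integral_mul_eq_setIntegral_twoDbar (ν := ν) hab hη
    (fun s hs => hp.hasDerivAt (h1 hs)) (hp.continuousOn_deriv.mono h1) hD.isPlaneDomain.1 hφ hu
    (fun s hs y hy => by
      rw [← hpt]
      exact (hside _ ⟨by simpa using hs, by simp; exact ⟨by linarith [hy.1], hy.2⟩⟩).2
        (by simpa using hy.1)) huc
    (fun y hy => by
      rw [← hpt]
      exact hzero _ ⟨by simp; linarith, by simp; exact ⟨by linarith [hy.1], hy.2⟩⟩
        fun h => by simpa using h.1.1)
    (fun y hy => by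
      rw [← hpt]
      exact hzero _ ⟨by simp; linarith, by simp; exact ⟨by linarith [hy.1], hy.2⟩⟩
        fun h => by simpa using h.1.2)
    (fun s hs => by
      rw [← hpt]
      exact hzero _ ⟨by simpa using hs, by simpa using hη.le⟩
        fun h => by simpa using h.2.2)
  have hleft : arcIntegral p (fun ζ => φ ζ * u ζ) =
      ∫ s in (s₀ - η)..(s₀ + η), φ (p s) * u (p s) * deriv p s := by
    rw [arcIntegral, intervalIntegral.integral_of_le zero_le_one,
      intervalIntegral.integral_of_le hab, MeasureTheory.integral_Ioc_eq_integral_Ioo,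
      MeasureTheory.integral_Ioc_eq_integral_Ioo]
    refine MeasureTheory.setIntegral_eq_of_subset_of_forall_sdiff_eq_zero measurableSet_Ioo
      (Ioo_subset_Icc_self.trans h1) fun s hs => ?_
    have : φ (p s) = 0 := by
      by_contra h
      obtain ⟨w, hw, he⟩ := hsupp (subset_tsupport φ h)
      refine hs.2 ?_
      have := huniq w (hopcl hw) s hs.1 he.symm
      simpa [this] using hw.1
    rw [this, zero_mul, zero_mul]
  have hright : ∫ z in D, twoDbar φ z * u z =
      ∫ w in Ioc (s₀ - η) (s₀ + η) ×ℂ Ioc 0 η, twoDbar φ (p w.re + w.im * ν) *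
        u (p w.re + w.im * ν) *
        (((deriv p w.re).re * ν.im - (deriv p w.re).im * ν.re : ℝ) : ℂ) := by
    have hmeas : MeasurableSet (Ioc (s₀ - η) (s₀ + η) ×ℂ Ioc 0 η) :=
      measurableSet_Ioc.reProdIm measurableSet_Ioc
    have hD1 : ∫ z in D, twoDbar φ z * u z =
        ∫ z in arcSweep p ν '' (Ioc (s₀ - η) (s₀ + η) ×ℂ Ioc 0 η), twoDbar φ z * u z := by
      refine MeasureTheory.setIntegral_eq_of_subset_of_forall_sdiff_eq_zero
        hD.isPlaneDomain.1.measurableSet ?_ fun z hz => ?_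
      · rintro _ ⟨w, hw, rfl⟩
        exact (hside w (hhalf hw)).2 hw.2.1
      · have : twoDbar φ z = 0 := by
          by_contra h
          obtain ⟨w, hw, rfl⟩ := hsupp (support_twoDbar_subset φ h)
          exact hz.2 ⟨w, ⟨Ioo_subset_Ioc_self hw.1, (hside w (hopcl hw)).1 hz.1, hw.2.2.le⟩, rfl⟩
        rw [this, zero_mul]
    rw [hD1, MeasureTheory.integral_image_eq_integral_abs_det_fderiv_smul MeasureTheory.volume
      hmeas (fun w hw => (hp.hasFDerivAt_arcSweep ν (h1 (hhalf hw).1)).hasFDerivWithinAt)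
      (hinj.mono hhalf)]
    refine MeasureTheory.setIntegral_congr_fun hmeas fun w hw => ?_
    rw [abs_of_pos (hdet _ (hhalf hw).1), arcSweepDeriv_det, arcSweep, Complex.real_smul, mul_comm]
  rw [hleft, hrect, hright]

/-- Green's formula for test functions supported near a given point of the disk. -/
theorem exists_green_nhds (hD : IsLune p D) {q : ℂ} (hq : q ∈ ball (0 : ℂ) 1) :
    ∃ V, IsOpen V ∧ q ∈ V ∧ ∀ u φ : ℂ → ℂ, DifferentiableOn ℂ u D →
      ContinuousOn u (closure D) → ContDiff ℝ 1 φ → HasCompactSupport φ → tsupport φ ⊆ V →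
      arcIntegral p (fun ζ => φ ζ * u ζ) = Complex.I * ∫ z in D, twoDbar φ z * u z := by
  by_cases hΓ : q ∈ arcTrace p
  · obtain ⟨s, hs, rfl⟩ := hΓ
    obtain ⟨V, hV, hqV, h⟩ := hD.exists_green_nhds_arc hs
    exact ⟨V, hV, hqV, fun u φ hu huc hφ _ hs => h u φ hu huc hφ hs⟩
  obtain ⟨D', hD', hdisj, hun⟩ := hD.divides
  -- For supports off the arc both sides vanish: in `D` the area integral is zero by the weak Cauchy
  -- theorem, in `D'` its integrand is zero on `D`.
  have harc : ∀ U ⊆ D ∪ D', ∀ φ u : ℂ → ℂ, tsupport φ ⊆ U →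
      arcIntegral p (fun ζ => φ ζ * u ζ) = 0 := by
    intro U hU φ u hs
    rw [arcIntegral, intervalIntegral.integral_of_le zero_le_one,
      MeasureTheory.integral_Ioc_eq_integral_Ioo]
    refine MeasureTheory.setIntegral_eq_zero_of_forall_eq_zero fun s hs' => ?_
    have : φ (p s) = 0 := by
      by_contra h
      have := hU (hs (subset_tsupport φ h))
      rw [hun] at this
      exact this.2 ⟨s, hs', rfl⟩
    rw [this, zero_mul, zero_mul]
  rcases (hun ▸ ⟨hq, hΓ⟩ : q ∈ D ∪ D') with h | h
  · refine ⟨D, hD.isPlaneDomain.1, h, fun u φ hu huc hφ hc hs => ?_⟩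
    rw [harc D subset_union_left φ u hs,
      setIntegral_twoDbar_mul_eq_zero hD.isPlaneDomain.1 hφ hc hs hu, mul_zero]
  · refine ⟨D', hD'.1, h, fun u φ hu huc hφ hc hs => ?_⟩
    rw [harc D' subset_union_right φ u hs,
      MeasureTheory.setIntegral_eq_zero_of_forall_eq_zero, mul_zero]
    intro z hz
    have : twoDbar φ z = 0 := by
      by_contra h
      exact hdisj.le_bot ⟨hz, hs (support_twoDbar_subset φ h)⟩
    rw [this, zero_mul]

open scoped Manifold ContDiff in
/-- Green's formula in a lune, for a test function with compact support in the disk times a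
holomorphic function that is continuous up to the boundary. -/
theorem arcIntegral_mul_eq (hD : IsLune p D) {u φ : ℂ → ℂ} (hu : DifferentiableOn ℂ u D)
    (huc : ContinuousOn u (closure D)) (hφ : ContDiff ℝ 1 φ) (hc : HasCompactSupport φ)
    (hs : tsupport φ ⊆ ball 0 1) :
    arcIntegral p (fun ζ => φ ζ * u ζ) = Complex.I * ∫ z in D, twoDbar φ z * u z := by
  choose! V hVo hVmem hV using fun q (hq : q ∈ ball (0 : ℂ) 1) => hD.exists_green_nhds hq
  obtain ⟨t, ht, hcov⟩ := hc.isCompact.elim_nhds_subcover V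
    fun q hq => (hVo q (hs hq)).mem_nhds (hVmem q (hs hq))
  obtain ⟨f, hf⟩ := SmoothPartitionOfUnity.exists_isSubordinate 𝓘(ℝ, ℂ) (isClosed_tsupport φ)
    (fun q : t => V q) (fun q => hVo q (hs (ht q q.2)))
    (by simpa [iUnion_subtype] using hcov)
  have hfφ : ∀ q : t, ContDiff ℝ 1 (fun z => (f q z : ℂ) * φ z) := fun q => by
    have h1 : ContDiff ℝ 1 (fun z => f q z) :=
      ((f q).contMDiff.contDiff).of_le (by exact_mod_cast le_top)
    exact (Complex.ofRealCLM.contDiff.comp h1).mul hφ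
  have hfc : ∀ q : t, HasCompactSupport (fun z => (f q z : ℂ) * φ z) := fun q => hc.mul_left
  have hfs : ∀ q : t, tsupport (fun z => (f q z : ℂ) * φ z) ⊆ V q := fun q => by
    refine (tsupport_mul_subset_left).trans (subset_trans ?_ (hf q))
    refine closure_mono fun z hz => ?_
    simpa using hz
  have hsum : ∀ z, φ z = ∑ q : t, (f q z : ℂ) * φ z := by
    intro z
    by_cases hz : z ∈ tsupport φ
    · have := f.sum_eq_one hz
      rw [finsum_eq_sum_of_fintype] at this
      rw [← Finset.sum_mul, ← Complex.ofReal_sum, this]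
      simp
    · simp [image_eq_zero_of_notMem_tsupport hz]
  have key : ∀ q : t, arcIntegral p (fun ζ => (f q ζ : ℂ) * φ ζ * u ζ) =
      Complex.I * ∫ z in D, twoDbar (fun z => (f q z : ℂ) * φ z) z * u z := fun q =>
    hV q (hs (ht q q.2)) u _ hu huc (hfφ q) (hfc q) (hfs q)
  have hL : arcIntegral p (fun ζ => φ ζ * u ζ) =
      ∑ q : t, arcIntegral p (fun ζ => (f q ζ : ℂ) * φ ζ * u ζ) := by
    simp only [arcIntegral]
    rw [← intervalIntegral.integral_finsetSum fun q _ =>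
      hD.isSmoothCrosscut.arcIntegrable (f := fun ζ => (f q ζ : ℂ) * φ ζ * u ζ)
        ((hfφ q).continuous.continuousOn.mul (huc.mono hD.image_subset_closure))]
    congr 1
    ext s
    rw [← Finset.sum_mul, ← Finset.sum_mul, ← hsum]
  have hR : ∫ z in D, twoDbar φ z * u z =
      ∑ q : t, ∫ z in D, twoDbar (fun z => (f q z : ℂ) * φ z) z * u z := by
    rw [← MeasureTheory.integral_finsetSum _ fun q _ =>
      hD.integrableOn (f := fun z => twoDbar (fun z => (f q z : ℂ) * φ z) z * u z) ((hfφ q).continuous_twoDbar.continuousOn.mul huc)]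
    congr 1
    ext z
    rw [← Finset.sum_mul, ← twoDbar_sum _ fun q _ => (hfφ q).differentiable one_ne_zero z]
    congr 2
    ext z
    exact hsum z
  rw [hL, hR, Finset.mul_sum]
  exact Finset.sum_congr rfl fun q _ => key q

end IsLune

/-! ### Radial cutoff functions and the mean value property -/

/-- The factor `z - c` is the point of choosing a function of `|z - c| ^ 2`: it cancels the Cauchy
kernel `(z - c)⁻¹`, leaving a continuous radial weight. -/
theorem twoDbar_comp_normSq {h : ℝ → ℝ} (hh : Differentiable ℝ h) (c z : ℂ) :
    twoDbar (fun z => (h (Complex.normSq (z - c)) : ℂ)) z =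
      2 * ((deriv h (Complex.normSq (z - c)) : ℝ) : ℂ) * (z - c) := by
  have h1 : HasFDerivAt (fun z : ℂ => z.re - c.re) Complex.reCLM z :=
    Complex.reCLM.hasFDerivAt.sub_const _
  have h2 : HasFDerivAt (fun z : ℂ => z.im - c.im) Complex.imCLM z :=
    Complex.imCLM.hasFDerivAt.sub_const _
  have h3 := (h1.mul h1).add (h2.mul h2)
  have h4 : (fun z : ℂ => (z.re - c.re) * (z.re - c.re) + (z.im - c.im) * (z.im - c.im)) =
      fun z => Complex.normSq (z - c) := by
    ext z; simp [Complex.normSq_apply]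
  have h5 : HasFDerivAt (fun z : ℂ => Complex.normSq (z - c))
      ((z.re - c.re) • Complex.reCLM + (z.re - c.re) • Complex.reCLM +
        ((z.im - c.im) • Complex.imCLM + (z.im - c.im) • Complex.imCLM)) z := by
    rw [← h4]; exact h3
  have h6 := ((hh (Complex.normSq (z - c))).hasDerivAt.comp_hasFDerivAt z h5)
  have h7 := (Complex.ofRealCLM.hasFDerivAt (x := h (Complex.normSq (z - c)))).comp z h6
  have h8 : fderiv ℝ (fun z => (h (Complex.normSq (z - c)) : ℂ)) z = _ := h7.fderiv
  rw [twoDbar, h8]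
  apply Complex.ext <;> simp <;> ring

/-- A smooth radial function of `|z - c|`, equal to `1` for `|z - c| ≤ r` and to `0` for
`|z - c| ≥ R`, as a function of `|z - c| ^ 2`. -/
noncomputable def cutoffProfile (r R t : ℝ) : ℝ :=
  1 - Real.smoothTransition ((t - r ^ 2) / (R ^ 2 - r ^ 2))

theorem contDiff_cutoffProfile (r R : ℝ) : ContDiff ℝ 1 (cutoffProfile r R) := by
  have h : ContDiff ℝ 1 Real.smoothTransition := Real.smoothTransition.contDiff (n := 1)
  exact contDiff_const.sub (h.comp ((contDiff_id.sub contDiff_const).div_const _))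

theorem cutoffProfile_of_le {r R t : ℝ} (hr : 0 ≤ r) (hrR : r < R) (ht : t ≤ r ^ 2) :
    cutoffProfile r R t = 1 := by
  have : r ^ 2 < R ^ 2 := by gcongr
  rw [cutoffProfile, Real.smoothTransition.zero_of_nonpos, sub_zero]
  exact div_nonpos_of_nonpos_of_nonneg (by linarith) (by linarith)

theorem cutoffProfile_of_ge {r R t : ℝ} (hr : 0 ≤ r) (hrR : r < R) (ht : R ^ 2 ≤ t) :
    cutoffProfile r R t = 0 := by
  have : r ^ 2 < R ^ 2 := by gcongr
  rw [cutoffProfile, Real.smoothTransition.one_of_one_le, sub_self]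
  rw [one_le_div (by linarith)]
  linarith

theorem deriv_cutoffProfile_of_lt {r R t : ℝ} (hr : 0 ≤ r) (hrR : r < R) (ht : t < r ^ 2) :
    deriv (cutoffProfile r R) t = 0 := by
  have : cutoffProfile r R =ᶠ[𝓝 t] fun _ => 1 := by
    filter_upwards [gt_mem_nhds ht] with x hx using cutoffProfile_of_le hr hrR hx.le
  rw [this.deriv_eq, deriv_const]

theorem deriv_cutoffProfile_of_gt {r R t : ℝ} (hr : 0 ≤ r) (hrR : r < R) (ht : R ^ 2 < t) :
    deriv (cutoffProfile r R) t = 0 := by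
  have : cutoffProfile r R =ᶠ[𝓝 t] fun _ => 0 := by
    filter_upwards [lt_mem_nhds ht] with x hx using cutoffProfile_of_ge hr hrR hx.le
  rw [this.deriv_eq, deriv_const]

/-- A smooth radial cutoff function, equal to `1` on the disk of radius `r` about `c` and vanishing
off the disk of radius `R`. -/
noncomputable def radialCutoff (c : ℂ) (r R : ℝ) (z : ℂ) : ℂ :=
  (cutoffProfile r R (Complex.normSq (z - c)) : ℂ)

theorem contDiff_radialCutoff (c : ℂ) (r R : ℝ) : ContDiff ℝ 1 (radialCutoff c r R) := by
  have h1 : ContDiff ℝ 1 (fun z : ℂ => Complex.normSq (z - c)) := by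
    have h4 : (fun z : ℂ => (z.re - c.re) * (z.re - c.re) + (z.im - c.im) * (z.im - c.im)) =
        fun z => Complex.normSq (z - c) := by
      ext z; simp [Complex.normSq_apply]
    rw [← h4]
    have hre : ContDiff ℝ 1 (fun z : ℂ => z.re - c.re) := Complex.reCLM.contDiff.sub contDiff_const
    have him : ContDiff ℝ 1 (fun z : ℂ => z.im - c.im) := Complex.imCLM.contDiff.sub contDiff_const
    exact (hre.mul hre).add (him.mul him)
  exact Complex.ofRealCLM.contDiff.comp ((contDiff_cutoffProfile r R).comp h1)

theorem radialCutoff_of_norm_le {c z : ℂ} {r R : ℝ} (hr : 0 ≤ r) (hrR : r < R)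
    (hz : ‖z - c‖ ≤ r) : radialCutoff c r R z = 1 := by
  rw [radialCutoff, cutoffProfile_of_le hr hrR, Complex.ofReal_one]
  rw [Complex.normSq_eq_norm_sq]
  gcongr

theorem radialCutoff_of_le_norm {c z : ℂ} {r R : ℝ} (hr : 0 ≤ r) (hrR : r < R)
    (hz : R ≤ ‖z - c‖) : radialCutoff c r R z = 0 := by
  rw [radialCutoff, cutoffProfile_of_ge hr hrR, Complex.ofReal_zero]
  rw [Complex.normSq_eq_norm_sq]
  have : 0 ≤ R := by linarith
  gcongr

theorem tsupport_radialCutoff_subset {c : ℂ} {r R : ℝ} (hr : 0 ≤ r) (hrR : r < R) :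
    tsupport (radialCutoff c r R) ⊆ closedBall c R := by
  refine closure_minimal (fun z hz => ?_) isClosed_closedBall
  rw [mem_closedBall, dist_eq_norm]
  by_contra! h
  exact hz (radialCutoff_of_le_norm hr hrR h.le)

theorem norm_one_sub_radialCutoff_le (c z : ℂ) (r R : ℝ) : ‖1 - radialCutoff c r R z‖ ≤ 1 := by
  rw [radialCutoff, cutoffProfile, Complex.ofReal_sub, Complex.ofReal_one, sub_sub_cancel,
    Complex.norm_real, Real.norm_of_nonneg (Real.smoothTransition.nonneg _)]
  exact Real.smoothTransition.le_one _

theorem twoDbar_radialCutoff (c z : ℂ) (r R : ℝ) :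
    twoDbar (radialCutoff c r R) z =
      2 * ((deriv (cutoffProfile r R) (Complex.normSq (z - c)) : ℝ) : ℂ) * (z - c) :=
  twoDbar_comp_normSq ((contDiff_cutoffProfile r R).differentiable one_ne_zero) c z

theorem twoDbar_radialCutoff_of_norm_lt {c z : ℂ} {r R : ℝ} (hr : 0 ≤ r) (hrR : r < R)
    (hz : ‖z - c‖ < r) : twoDbar (radialCutoff c r R) z = 0 := by
  rw [twoDbar_radialCutoff, deriv_cutoffProfile_of_lt hr hrR]
  · simp
  · rw [Complex.normSq_eq_norm_sq]
    gcongr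

/-- The mean value property, integrated against a radial weight. -/
theorem setIntegral_deriv_cutoffProfile_mul {U : Set ℂ} {v : ℂ → ℂ}
    (hv : DifferentiableOn ℂ v U) {c : ℂ} {r R : ℝ} (hr : 0 < r) (hrR : r < R)
    (hcU : closedBall c R ⊆ U) :
    ∫ z in U, 2 * ((deriv (cutoffProfile r R) (Complex.normSq (z - c)) : ℝ) : ℂ) * v z =
      -(2 * Real.pi * v c) := by
  set g : ℂ → ℂ := fun z => 2 * ((deriv (cutoffProfile r R) (Complex.normSq (z - c)) : ℝ) : ℂ) * v z
    with hg
  have hR : 0 < R := hr.trans hrR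
  have hgzero : ∀ z, R < ‖z - c‖ → g z = 0 := by
    intro z hz
    have : deriv (cutoffProfile r R) (Complex.normSq (z - c)) = 0 := by
      apply deriv_cutoffProfile_of_gt hr.le hrR
      rw [Complex.normSq_eq_norm_sq]
      gcongr
    simp [hg, this]
  have h1 : ∫ z in U, g z = ∫ z, g (c + z) := by
    rw [MeasureTheory.setIntegral_eq_integral_of_forall_compl_eq_zero,
      MeasureTheory.integral_add_left_eq_self]
    intro z hz
    apply hgzero
    by_contra! h
    exact hz (hcU (by rwa [mem_closedBall, dist_eq_norm]))
  have hcirc : ∀ q : ℝ × ℝ, c + Complex.polarCoord.symm q = circleMap c q.1 q.2 := by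
    intro q
    simp [circleMap, Complex.exp_mul_I]
  have hnorm : ∀ ρ θ : ℝ, ‖circleMap c ρ θ - c‖ = |ρ| := by
    intro ρ θ; simp [circleMap]
  rw [h1, ← Complex.integral_comp_polarCoord_symm, polarCoord_target]
  simp_rw [hcirc]
  have h2 : ∫ q in Ioi (0 : ℝ) ×ˢ Ioo (-Real.pi) Real.pi, q.1 • g (circleMap c q.1 q.2) =
      ∫ q in Ioc (0 : ℝ) R ×ˢ Ioc (-Real.pi) Real.pi, q.1 • g (circleMap c q.1 q.2) := by
    have h3 : (Ioc (0 : ℝ) R ×ˢ Ioo (-Real.pi) Real.pi : Set (ℝ × ℝ)) =ᵐ[MeasureTheory.volume]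
        (Ioc (0 : ℝ) R ×ˢ Ioc (-Real.pi) Real.pi : Set (ℝ × ℝ)) :=
      MeasureTheory.Measure.set_prod_ae_eq (Filter.EventuallyEq.refl _ _)
        MeasureTheory.Ioo_ae_eq_Ioc
    rw [← MeasureTheory.setIntegral_congr_set h3]
    refine MeasureTheory.setIntegral_eq_of_subset_of_forall_sdiff_eq_zero
      (measurableSet_Ioi.prod measurableSet_Ioo) (prod_mono Ioc_subset_Ioi_self subset_rfl) ?_
    rintro ⟨ρ, θ⟩ ⟨⟨hρ, hθ⟩, hn⟩
    simp only [mem_Ioi] at hρ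
    rw [hgzero, smul_zero]
    rw [hnorm, abs_of_pos hρ]
    by_contra! h
    exact hn ⟨⟨hρ, h⟩, hθ⟩
  have hcont : ContinuousOn (fun q : ℝ × ℝ => q.1 • g (circleMap c q.1 q.2))
      (Icc 0 R ×ˢ Icc (-Real.pi) Real.pi) := by
    have hc1 : Continuous (fun q : ℝ × ℝ => circleMap c q.1 q.2) := by
      unfold circleMap; fun_prop
    have hc2 : ContinuousOn g (closedBall c R) := by
      have := (contDiff_cutoffProfile r R).continuous_deriv le_rfl
      have hn : Continuous (fun z : ℂ => Complex.normSq (z - c)) := by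
        have := Complex.continuous_normSq
        fun_prop
      refine ContinuousOn.mul (Continuous.continuousOn ?_) (hv.continuousOn.mono hcU)
      exact continuous_const.mul (Complex.continuous_ofReal.comp (this.comp hn))
    refine continuous_fst.continuousOn.smul (hc2.comp hc1.continuousOn ?_)
    rintro ⟨ρ, θ⟩ ⟨hρ, -⟩
    rw [mem_closedBall, dist_eq_norm, hnorm, abs_of_nonneg hρ.1]
    exact hρ.2
  have hmean : ∀ ρ ∈ Ioc 0 R, ∫ θ in Ioc (-Real.pi) Real.pi, v (circleMap c ρ θ) =
      2 * Real.pi * v c := by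
    intro ρ hρ
    have hb : closedBall c |ρ| ⊆ U := by
      rw [abs_of_pos hρ.1]; exact (closedBall_subset_closedBall hρ.2).trans hcU
    have hdc : DiffContOnCl ℂ v (ball c |ρ|) := (hv.mono hb).diffContOnCl_ball subset_rfl
    have hav := hdc.circleAverage
    have hper := (periodic_circleMap c ρ).comp v
    rw [Real.circleAverage_def] at hav
    have hsh := hper.intervalIntegral_add_eq (-Real.pi) 0
    simp only [zero_add, show -Real.pi + 2 * Real.pi = Real.pi by ring] at hsh
    rw [← intervalIntegral.integral_of_le (by linarith [Real.pi_pos])]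
    simp only [Function.comp_apply] at hsh
    rw [hsh, ← hav, Complex.real_smul]
    push_cast
    field_simp [Real.pi_ne_zero]
  have hint := (hcont.integrableOn_compact (μ := MeasureTheory.volume)
    (isCompact_Icc.prod isCompact_Icc)).mono_set
      (prod_mono (Ioc_subset_Icc_self (a := 0) (b := R))
        (Ioc_subset_Icc_self (a := -Real.pi) (b := Real.pi)))
  rw [MeasureTheory.Measure.volume_eq_prod] at hint
  rw [h2, MeasureTheory.Measure.volume_eq_prod, MeasureTheory.setIntegral_prod _ hint]
  have h4 : ∀ ρ ∈ Ioc 0 R,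
      ∫ θ in Ioc (-Real.pi) Real.pi, (ρ, θ).1 • g (circleMap c (ρ, θ).1 (ρ, θ).2) =
      ((deriv (cutoffProfile r R) (ρ ^ 2) * (2 * ρ) : ℝ) : ℂ) * (2 * Real.pi * v c) := by
    intro ρ hρ
    rw [← hmean ρ hρ, ← MeasureTheory.integral_const_mul]
    congr 1
    ext θ
    simp only [hg, Complex.normSq_eq_norm_sq, hnorm, sq_abs, Complex.real_smul]
    push_cast
    ring
  rw [MeasureTheory.setIntegral_congr_fun measurableSet_Ioc h4,
    MeasureTheory.integral_mul_const, integral_complex_ofReal,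
    ← intervalIntegral.integral_of_le hR.le]
  -- The radial weight is an exact derivative, with integral `0 - 1` because the profile falls from
  -- `1` at the centre to `0` at radius `R`.
  have hderiv : ∀ ρ ∈ uIcc 0 R, HasDerivAt (fun ρ : ℝ => cutoffProfile r R (ρ ^ 2))
      (deriv (cutoffProfile r R) (ρ ^ 2) * (2 * ρ)) ρ := by
    intro ρ _
    have := (((contDiff_cutoffProfile r R).differentiable one_ne_zero) (ρ ^ 2)).hasDerivAt
    have h5 : HasDerivAt (fun ρ : ℝ => ρ ^ 2) (2 * ρ) ρ := by simpa using hasDerivAt_pow 2 ρ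
    exact HasDerivAt.comp (h := fun ρ : ℝ => ρ ^ 2) (h₂ := cutoffProfile r R) ρ this h5
  rw [intervalIntegral.integral_eq_sub_of_hasDerivAt hderiv,
    cutoffProfile_of_ge hr.le hrR le_rfl, cutoffProfile_of_le hr.le hrR (by simpa using sq_nonneg r)]
  · push_cast; ring
  · have := (contDiff_cutoffProfile r R).continuous_deriv le_rfl
    exact Continuous.intervalIntegrable (by fun_prop) _ _

/-! ### The Cauchy–Pompeiu formula and the Carleman estimate -/

namespace IsLune

variable {p : ℝ → ℂ} {D : Set ℂ}

/-- The Cauchy–Pompeiu formula in a lune, localized by a cutoff function. -/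
theorem arcIntegral_cutoff_eq (hD : IsLune p D) {v χ : ℂ → ℂ} (hv : DifferentiableOn ℂ v D)
    (hvc : ContinuousOn v (closure D)) (hχ : ContDiff ℝ 1 χ) (hc : HasCompactSupport χ)
    (hs : tsupport χ ⊆ ball 0 1) {z : ℂ} (hz : z ∈ D) (hχz : ∀ᶠ ζ in 𝓝 z, χ ζ = 1) :
    arcIntegral p (fun ζ => χ ζ * (ζ - z)⁻¹ * v ζ) =
      2 * Real.pi * Complex.I * v z +
        Complex.I * ∫ ζ in D, twoDbar χ ζ * (ζ - z)⁻¹ * v ζ := by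
  have hDo := hD.isPlaneDomain.1
  obtain ⟨R, hR, hball⟩ := Metric.nhds_basis_closedBall.mem_iff.1
    (inter_mem (hDo.mem_nhds hz) hχz)
  have hr : 0 < R / 2 := half_pos hR
  have hrR : R / 2 < R := half_lt_self hR
  -- The singularity at `z` is removed by a second cutoff `ψ` supported in a closed disk inside `D`.
  -- Then `(χ - ψ) / (ζ - z)` vanishes near `z` and is an admissible test function; `ψ` does not
  -- meet the arc, and its area term yields `v z` by the mean value property.
  set ψ := radialCutoff z (R / 2) R with hψ
  have hψc : ContDiff ℝ 1 ψ := contDiff_radialCutoff _ _ _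
  have hψ1 : ∀ ζ ∈ ball z (R / 2), ψ ζ = 1 := fun ζ hζ =>
    radialCutoff_of_norm_le hr.le hrR (by rw [← dist_eq_norm]; exact (mem_ball.1 hζ).le)
  have hψ0 : ∀ ζ ∉ closedBall z R, ψ ζ = 0 := fun ζ hζ =>
    radialCutoff_of_le_norm hr.le hrR (by
      rw [← dist_eq_norm]; exact (not_le.1 (fun h => hζ (mem_closedBall.2 h))).le)
  set φ : ℂ → ℂ := fun ζ => (χ ζ - ψ ζ) * (ζ - z)⁻¹ with hφ
  have hnear : ∀ ζ ∈ ball z (R / 2), χ ζ - ψ ζ = 0 := fun ζ hζ => by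
    have : χ ζ = 1 := (hball (ball_subset_closedBall (ball_subset_ball hrR.le hζ))).2
    rw [this, hψ1 ζ hζ, sub_self]
  have hmemball : ball z (R / 2) ∈ 𝓝 z := ball_mem_nhds z hr
  have hφz : φ =ᶠ[𝓝 z] fun _ => 0 := by
    filter_upwards [hmemball] with ζ hζ
    simp [hφ, hnear ζ hζ]
  have hinv : ∀ ζ, ζ ≠ z → DifferentiableAt ℂ (fun ζ => (ζ - z)⁻¹) ζ := fun ζ hζ =>
    (differentiableAt_id.sub_const z).inv (sub_ne_zero.2 hζ)
  have hφc : ContDiff ℝ 1 φ := by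
    rw [contDiff_iff_contDiffAt]
    intro ζ
    rcases eq_or_ne ζ z with rfl | hζ
    · exact contDiffAt_const.congr_of_eventuallyEq hφz
    · refine (hχ.contDiffAt.sub hψc.contDiffAt).mul ?_
      exact (contDiffAt_id.sub contDiffAt_const).inv (sub_ne_zero.2 hζ)
  have hsupp : tsupport φ ⊆ tsupport χ ∪ closedBall z R := by
    refine closure_minimal (fun ζ hζ => ?_) ((isClosed_tsupport χ).union isClosed_closedBall)
    by_contra h
    rw [mem_union, not_or] at h
    exact hζ (by simp [hφ, hψ0 ζ h.2, image_eq_zero_of_notMem_tsupport h.1])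
  have hφcs : HasCompactSupport φ :=
    (hc.isCompact.union (isCompact_closedBall z R)).of_isClosed_subset (isClosed_tsupport _) hsupp
  have hφs : tsupport φ ⊆ ball 0 1 :=
    hsupp.trans (union_subset hs (fun ζ hζ => hD.subset_ball (hball hζ).1))
  have hgreen := hD.arcIntegral_mul_eq hv hvc hφc hφcs hφs
  have hleft : arcIntegral p (fun ζ => φ ζ * v ζ) =
      arcIntegral p (fun ζ => χ ζ * (ζ - z)⁻¹ * v ζ) := by
    refine intervalIntegral.integral_congr fun s hs => ?_
    rw [uIcc_of_le zero_le_one] at hs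
    have : ψ (p s) = 0 := hψ0 _ fun h =>
      disjoint_left.1 hD.disjoint_image (hball h).1 ⟨s, hs, rfl⟩
    simp only [hφ, this, sub_zero]
  have hdbar : ∀ ζ, twoDbar χ ζ * (ζ - z)⁻¹ * v ζ = twoDbar φ ζ * v ζ +
      2 * ((deriv (cutoffProfile (R / 2) R) (Complex.normSq (ζ - z)) : ℝ) : ℂ) * v ζ := by
    intro ζ
    rw [← add_mul]
    congr 1
    -- At `ζ = z` the left side is `0` by the convention `0⁻¹ = 0`; on the right, `φ` vanishes near
    -- `z` and the profile is constant near `0`.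
    rcases eq_or_ne ζ z with rfl | hζ
    · have h1 : twoDbar φ ζ = 0 := by
        rw [twoDbar, hφz.fderiv_eq]; simp
      rw [h1, deriv_cutoffProfile_of_lt hr.le hrR (by simpa using pow_pos hr 2)]
      simp
    · have h1 : twoDbar φ ζ = twoDbar (fun ζ => χ ζ - ψ ζ) ζ * (ζ - z)⁻¹ :=
        twoDbar_mul_of_differentiableAt (φ := fun ζ => χ ζ - ψ ζ)
          ((hχ.differentiable one_ne_zero ζ).sub (hψc.differentiable one_ne_zero ζ)) (hinv ζ hζ)
      have h2 : twoDbar χ ζ = twoDbar (fun ζ => χ ζ - ψ ζ) ζ + twoDbar ψ ζ := by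
        rw [← twoDbar_add (φ := fun ζ => χ ζ - ψ ζ) ((hχ.differentiable one_ne_zero ζ).sub
          (hψc.differentiable one_ne_zero ζ)) (hψc.differentiable one_ne_zero ζ)]
        simp
      rw [h1, h2, add_mul, twoDbar_radialCutoff, mul_inv_cancel_right₀ (sub_ne_zero.2 hζ)]
  have hi1 : MeasureTheory.IntegrableOn (fun ζ => twoDbar φ ζ * v ζ) D :=
    hD.integrableOn (hφc.continuous_twoDbar.continuousOn.mul hvc)
  have hi2 : MeasureTheory.IntegrableOn (fun ζ =>
      2 * ((deriv (cutoffProfile (R / 2) R) (Complex.normSq (ζ - z)) : ℝ) : ℂ) * v ζ) D := by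
    refine hD.integrableOn (ContinuousOn.mul (Continuous.continuousOn ?_) hvc)
    have h1 := (contDiff_cutoffProfile (R / 2) R).continuous_deriv le_rfl
    have h2 : Continuous (fun ζ : ℂ => Complex.normSq (ζ - z)) := by
      have := Complex.continuous_normSq
      fun_prop
    exact continuous_const.mul (Complex.continuous_ofReal.comp (h1.comp h2))
  simp_rw [hdbar]
  rw [MeasureTheory.integral_add hi1 hi2, setIntegral_deriv_cutoffProfile_mul hv hr hrR
    (fun ζ hζ => (hball hζ).1), ← hleft, hgreen]
  ring

theorem arcIntegrable_carlemanIntegrand (hD : IsLune p D) {u : ℂ → ℂ}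
    (huc : ContinuousOn u (closure D)) {a z : ℂ} (ha : a ∉ closure D) (hz : z ∈ D) (N : ℕ) :
    ArcIntegrable p (carlemanIntegrand u a z N) := by
  refine hD.isSmoothCrosscut.arcIntegrable ?_
  unfold carlemanIntegrand
  refine ((huc.mono hD.image_subset_closure).div (by fun_prop) fun ζ hζ => ?_).mul
    ((continuousOn_const.div (by fun_prop) fun ζ hζ => ?_).pow _)
  · rw [sub_ne_zero]
    rintro rfl
    exact disjoint_left.1 hD.disjoint_image hz hζ
  · rw [sub_ne_zero]
    rintro rfl
    exact ha (hD.image_subset_closure hζ)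

/-- The Carleman integrals approximate `u` geometrically fast. -/
theorem exists_norm_carleman_sub_le (hD : IsLune p D) {u : ℂ → ℂ} (hu : DifferentiableOn ℂ u D)
    (huc : ContinuousOn u (closure D)) {K : Set ℂ} (hK : IsCompact K) (hKD : K ⊆ D) :
    ∃ C q δ : ℝ, 0 ≤ q ∧ q < 1 ∧ 0 < δ ∧ ∀ a ∉ closure D, ‖a‖ < δ → ∀ z ∈ K, ∀ N : ℕ,
      ‖1 / (2 * (Real.pi : ℂ) * Complex.I) * arcIntegral p (carlemanIntegrand u a z N) - u z‖ ≤
        C * q ^ (N + 1) := by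
  obtain ⟨ρ', hρ'1, hKρ'⟩ := exists_lt_subset_ball hK.isClosed (hKD.trans hD.subset_ball)
  obtain ⟨ρ, hρ0, hρ1, hKρ⟩ : ∃ ρ : ℝ, 0 ≤ ρ ∧ ρ < 1 ∧ ∀ z ∈ K, ‖z‖ ≤ ρ := by
    refine ⟨max ρ' 0, le_max_right _ _, max_lt hρ'1 one_pos, fun z hz => ?_⟩
    have := hKρ' hz
    rw [mem_ball_zero_iff] at this
    exact this.le.trans (le_max_left _ _)
  obtain ⟨r, hρr, hr1⟩ := exists_between hρ1
  obtain ⟨R, hrR, hR1⟩ := exists_between hr1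
  have hr0 : 0 < r := hρ0.trans_lt hρr
  set χ := radialCutoff 0 r R with hχdef
  have hχ : ContDiff ℝ 1 χ := contDiff_radialCutoff _ _ _
  have hχsub : tsupport χ ⊆ closedBall 0 R := tsupport_radialCutoff_subset hr0.le hrR
  have hχc : HasCompactSupport χ :=
    (isCompact_closedBall (0 : ℂ) R).of_isClosed_subset (isClosed_tsupport _) hχsub
  have hχs : tsupport χ ⊆ ball 0 1 := hχsub.trans (closedBall_subset_ball hR1)
  have hχ1 : ∀ ζ, ‖ζ‖ ≤ r → χ ζ = 1 := fun ζ hζ =>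
    radialCutoff_of_norm_le hr0.le hrR (by simpa using hζ)
  have hdχ : ∀ ζ, ‖ζ‖ < r → twoDbar χ ζ = 0 := fun ζ hζ =>
    twoDbar_radialCutoff_of_norm_lt hr0.le hrR (by simpa using hζ)
  obtain ⟨M, hM⟩ := hD.isCompact_closure.exists_bound_of_continuousOn huc
  obtain ⟨A, hA⟩ := hD.isCompact_closure.exists_bound_of_continuousOn
    hχ.continuous_twoDbar.continuousOn
  obtain ⟨d, hd⟩ := hD.isPlaneDomain.2.nonempty
  have hM0 : 0 ≤ M := (norm_nonneg _).trans (hM d (subset_closure hd))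
  have hA0 : 0 ≤ A := (norm_nonneg _).trans (hA d (subset_closure hd))
  -- Any `δ < (r - ρ) / 2` makes `ρ + δ < r - δ`, that is `q < 1`.
  set δ := (r - ρ) / 4 with hδ
  have hδ0 : 0 < δ := by rw [hδ]; linarith
  have hrδ : 0 < r - δ := by rw [hδ]; linarith
  set q := (ρ + δ) / (r - δ) with hq
  have hq0 : 0 ≤ q := by positivity
  have hq1 : q < 1 := by rw [hq, div_lt_one hrδ, hδ]; linarith
  set L := ∫ s in (0 : ℝ)..1, ‖deriv p s‖ with hL
  set V := MeasureTheory.volume.real D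
  have hp := hD.isSmoothCrosscut
  have hpi : ‖1 / (2 * (Real.pi : ℂ) * Complex.I)‖ = 1 / (2 * Real.pi) := by
    simp [abs_of_pos Real.pi_pos]
  refine ⟨1 / (2 * Real.pi) * (M * (r - ρ)⁻¹ * L + A * (r - ρ)⁻¹ * M * V), q, δ, hq0, hq1, hδ0,
    fun a ha haδ z hz N => ?_⟩
  have hzD := hKD hz
  have hza : z - a ≠ 0 := by
    rw [sub_ne_zero]; rintro rfl; exact ha (subset_closure hzD)
  have hζa : ∀ ζ ∈ closure D, ζ - a ≠ 0 := fun ζ hζ => by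
    rw [sub_ne_zero]; rintro rfl; exact ha hζ
  -- The power is absorbed into the holomorphic function; it equals `1` at `ζ = z`, so Cauchy's
  -- formula for `v` still returns `u z`.
  set v : ℂ → ℂ := fun ζ => u ζ * ((z - a) / (ζ - a)) ^ (N + 1) with hv
  have hvd : DifferentiableOn ℂ v D :=
    hu.mul (((differentiableOn_const _).div (differentiableOn_id.sub_const a)
      fun ζ hζ => hζa ζ (subset_closure hζ)).pow _)
  have hvc : ContinuousOn v (closure D) :=
    huc.mul ((continuousOn_const.div (by fun_prop) hζa).pow _)
  have hvz : v z = u z := by simp [hv, div_self hza]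
  have hratio : ∀ ζ, r ≤ ‖ζ‖ → ‖((z - a) / (ζ - a)) ^ (N + 1)‖ ≤ q ^ (N + 1) := by
    intro ζ hζ
    rw [norm_pow, norm_div]
    have h1 : ‖z - a‖ ≤ ρ + δ := (norm_sub_le _ _).trans (add_le_add (hKρ z hz) haδ.le)
    have h2 : r - δ ≤ ‖ζ - a‖ := by
      have := norm_sub_norm_le ζ a
      linarith
    exact pow_le_pow_left₀ (by positivity)
      (div_le_div₀ (by positivity) h1 hrδ h2) _
  have hvb : ∀ ζ ∈ closure D, r ≤ ‖ζ‖ → ‖v ζ‖ ≤ M * q ^ (N + 1) := by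
    intro ζ hζ hrζ
    rw [hv, norm_mul]
    exact mul_le_mul (hM ζ hζ) (hratio ζ hrζ) (norm_nonneg _) hM0
  have hinvb : ∀ ζ, r ≤ ‖ζ‖ → ‖(ζ - z)⁻¹‖ ≤ (r - ρ)⁻¹ := by
    intro ζ hζ
    rw [norm_inv]
    refine inv_anti₀ (by linarith) ?_
    have := norm_sub_norm_le ζ z
    linarith [hKρ z hz]
  have hζz : ∀ ζ ∈ p '' Icc 0 1, ζ - z ≠ 0 := fun ζ hζ => by
    rw [sub_ne_zero]; rintro rfl; exact disjoint_left.1 hD.disjoint_image hzD hζ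
  have hχz : ∀ᶠ ζ in 𝓝 z, χ ζ = 1 := by
    have : ∀ᶠ ζ in 𝓝 z, ‖ζ‖ < r :=
      continuous_norm.continuousAt.eventually (gt_mem_nhds ((hKρ z hz).trans_lt hρr))
    exact this.mono fun ζ hζ => hχ1 ζ hζ.le
  have hcauchy := hD.arcIntegral_cutoff_eq hvd hvc hχ hχc hχs hzD hχz
  have hcontinv : ContinuousOn (fun ζ => (ζ - z)⁻¹) (p '' Icc 0 1) :=
    ContinuousOn.inv₀ (by fun_prop) hζz
  have hvc' := hvc.mono hD.image_subset_closure
  have hsplit : arcIntegral p (carlemanIntegrand u a z N) =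
      arcIntegral p (fun ζ => χ ζ * (ζ - z)⁻¹ * v ζ) +
        arcIntegral p (fun ζ => (1 - χ ζ) * (ζ - z)⁻¹ * v ζ) := by
    simp only [arcIntegral]
    rw [← intervalIntegral.integral_add
      (hp.arcIntegrable (f := fun ζ => χ ζ * (ζ - z)⁻¹ * v ζ)
        ((hχ.continuous.continuousOn.mul hcontinv).mul hvc'))
      (hp.arcIntegrable (f := fun ζ => (1 - χ ζ) * (ζ - z)⁻¹ * v ζ) (((continuousOn_const.sub hχ.continuous.continuousOn).mul
        hcontinv).mul hvc'))]
    congr 1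
    ext s
    simp only [carlemanIntegrand, hv]
    ring
  have herr1 : ‖arcIntegral p (fun ζ => (1 - χ ζ) * (ζ - z)⁻¹ * v ζ)‖ ≤
      M * (r - ρ)⁻¹ * L * q ^ (N + 1) := by
    have h1 : M * (r - ρ)⁻¹ * L * q ^ (N + 1) =
        ∫ s in (0 : ℝ)..1, (r - ρ)⁻¹ * (M * q ^ (N + 1)) * ‖deriv p s‖ := by
      rw [intervalIntegral.integral_const_mul]; ring
    rw [h1]
    refine intervalIntegral.norm_integral_le_of_norm_le zero_le_one
      (Eventually.of_forall fun s hs => ?_) (hp.finite_length.norm.const_mul _)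
    have hps : p s ∈ closure D :=
      hD.image_subset_closure ⟨s, Ioc_subset_Icc_self hs, rfl⟩
    rw [norm_mul]
    refine mul_le_mul_of_nonneg_right ?_ (norm_nonneg _)
    have hrρ : 0 ≤ (r - ρ)⁻¹ := inv_nonneg.2 (by linarith)
    -- Inside radius `r`, where the power may be huge, `1 - χ` vanishes; outside, the geometric
    -- bound applies.
    rcases lt_or_ge ‖p s‖ r with h | h
    · simp only [hχ1 _ h.le, sub_self, zero_mul, norm_zero]
      positivity
    · rw [norm_mul, norm_mul]
      have h2 : ‖1 - χ (p s)‖ * ‖(p s - z)⁻¹‖ ≤ 1 * (r - ρ)⁻¹ :=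
        mul_le_mul (norm_one_sub_radialCutoff_le _ _ _ _) (hinvb _ h) (norm_nonneg _) zero_le_one
      rw [one_mul] at h2
      exact mul_le_mul h2 (hvb _ hps h) (norm_nonneg _) hrρ
  have hvol : MeasureTheory.volume D < ⊤ :=
    (MeasureTheory.measure_mono subset_closure).trans_lt hD.isCompact_closure.measure_lt_top
  have herr2 : ‖∫ ζ in D, twoDbar χ ζ * (ζ - z)⁻¹ * v ζ‖ ≤
      A * (r - ρ)⁻¹ * M * V * q ^ (N + 1) := by
    have h1 : ‖∫ ζ in D, twoDbar χ ζ * (ζ - z)⁻¹ * v ζ‖ ≤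
        A * (r - ρ)⁻¹ * (M * q ^ (N + 1)) * V := by
      refine MeasureTheory.norm_setIntegral_le_of_norm_le_const hvol fun ζ hζ => ?_
      have hζ' := subset_closure hζ
      have hrρ : 0 ≤ (r - ρ)⁻¹ := inv_nonneg.2 (by linarith)
      rcases lt_or_ge ‖ζ‖ r with h | h
      · rw [hdχ _ h]
        simp only [zero_mul, norm_zero]
        positivity
      · rw [norm_mul, norm_mul]
        exact mul_le_mul (mul_le_mul (hA ζ hζ') (hinvb _ h) (norm_nonneg _) hA0)
          (hvb _ hζ' h) (norm_nonneg _) (by positivity)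
    linarith
  have hfinal : 1 / (2 * (Real.pi : ℂ) * Complex.I) * arcIntegral p (carlemanIntegrand u a z N)
      - u z = 1 / (2 * (Real.pi : ℂ) * Complex.I) *
        (arcIntegral p (fun ζ => (1 - χ ζ) * (ζ - z)⁻¹ * v ζ) +
          Complex.I * ∫ ζ in D, twoDbar χ ζ * (ζ - z)⁻¹ * v ζ) := by
    rw [hsplit, hcauchy, hvz]
    have : (2 * (Real.pi : ℂ) * Complex.I) ≠ 0 := Complex.two_pi_I_ne_zero
    field_simp
    ring
  rw [hfinal, norm_mul, hpi, mul_assoc]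
  refine mul_le_mul_of_nonneg_left ?_ (by positivity)
  refine (norm_add_le _ _).trans ?_
  rw [norm_mul, Complex.norm_I, one_mul, add_mul]
  exact add_le_add herr1 herr2

end IsLune

/-! ### Transversality and conclusion -/

/-- An arc issuing transversally from a crosscut leaves it immediately. -/
theorem IsSmoothCrosscut.eventually_notMem_arcTrace {p γ : ℝ → ℂ} (hp : IsSmoothCrosscut p)
    (hγ : DifferentiableWithinAt ℝ γ (Ici 0) 0) (htrans : TransversalAtStart p γ) :
    ∀ᶠ t : ℝ in 𝓝[>] 0, γ t ∉ arcTrace p := by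
  obtain ⟨s₀, hs₀, hps, hlin⟩ := htrans
  obtain ⟨η, hη, -, -, -, -, -, huniq⟩ := hp.exists_box hs₀
  set ν := Complex.I * deriv p s₀ with hν
  set Φ := arcSweep p ν
  have hdet : (arcSweepDeriv (deriv p s₀) ν).det ≠ 0 := by
    have h1 : Complex.normSq (deriv p s₀) ≠ 0 :=
      (Complex.normSq_pos.2 (hp.deriv_ne_zero s₀ hs₀)).ne'
    rw [Complex.normSq_apply] at h1
    simpa [arcSweepDeriv_det, hν] using h1
  set e := (arcSweepDeriv (deriv p s₀) ν).toContinuousLinearEquivOfDetNeZero hdet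
  have hs₀' : (s₀ : ℂ).re ∈ Ioo (0 : ℝ) 1 := by simpa using hs₀
  have hfd : HasFDerivAt Φ (e : ℂ →L[ℝ] ℂ) (s₀ : ℂ) := by
    simpa [e] using hp.hasFDerivAt_arcSweep ν hs₀'
  have hstrict : HasStrictFDerivAt Φ (e : ℂ →L[ℝ] ℂ) (s₀ : ℂ) :=
    (hp.contDiffAt_arcSweep ν hs₀').hasStrictFDerivAt' hfd one_ne_zero
  have hΦγ : Φ s₀ = γ 0 := (arcSweep_ofReal _ _ _).trans hps
  set g := hstrict.localInverse Φ e s₀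
  have hg : HasFDerivAt g (e.symm : ℂ →L[ℝ] ℂ) (γ 0) := by
    rw [← hΦγ]; exact hstrict.to_localInverse.hasFDerivAt
  have hgγ0 : g (γ 0) = s₀ := by rw [← hΦγ]; exact hstrict.localInverse_apply_image
  have hγt : Tendsto γ (𝓝[>] 0) (𝓝 (γ 0)) :=
    hγ.continuousWithinAt.tendsto.mono_left (nhdsWithin_mono _ Ioi_subset_Ici_self)
  have hright : ∀ᶠ t : ℝ in 𝓝[>] 0, Φ (g (γ t)) = γ t :=
    hγt.eventually (by rw [← hΦγ]; exact hstrict.eventually_right_inverse)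
  have hbox : ∀ᶠ t : ℝ in 𝓝[>] 0, g (γ t) ∈ Ioo (s₀ - η) (s₀ + η) ×ℂ Ioo (-η) η := by
    refine (hg.continuousAt.tendsto.comp hγt).eventually
      ((isOpen_Ioo.reProdIm isOpen_Ioo).mem_nhds ?_)
    rw [hgγ0]
    exact ⟨by simp [hη], by simpa using hη⟩
  have him : HasDerivWithinAt (fun t => (g (γ t)).im)
      (e.symm (derivWithin γ (Ici 0) 0)).im (Ici 0) 0 :=
    Complex.imCLM.hasFDerivAt.comp_hasDerivWithinAt (0 : ℝ)
      (hg.comp_hasDerivWithinAt (0 : ℝ) hγ.hasDerivWithinAt)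
  -- In straightened coordinates the arc is the real axis, and `e` sends reals to real multiples of
  -- `p' s₀`. A velocity with zero imaginary part would make `γ'` a multiple of `p' s₀`.
  have hne : (e.symm (derivWithin γ (Ici 0) 0)).im ≠ 0 := by
    intro h
    have h1 : e (e.symm (derivWithin γ (Ici 0) 0)) = derivWithin γ (Ici 0) 0 :=
      e.apply_symm_apply _
    have hreal : ∀ x : ℂ, x.im = 0 → e x = x.re • deriv p s₀ := fun x hx => by
      simp [e, arcSweepDeriv, hx]
    have h2 := hreal _ h
    have h3 := LinearIndependent.pair_iff.1 hlin (e.symm (derivWithin γ (Ici 0) 0)).re (-1)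
      (by rw [← h2, h1]; simp)
    simpa using h3.2
  have hev := him.eventually_ne (c := 0) hne
  rw [Ici_sdiff_left] at hev
  filter_upwards [hright, hbox, hev] with t h1 h2 h3 h4
  obtain ⟨s, hs, hst⟩ := h4
  -- The uniqueness clause of the box excludes returns to distant parts of the arc as well as to the
  -- nearby piece.
  have := huniq (g (γ t)) ⟨Ioo_subset_Icc_self h2.1, Ioo_subset_Icc_self h2.2⟩ s hs
    (hst.trans h1.symm)
  exact h3 (by rw [this, Complex.ofReal_im])

/-- Such a point lies in the other domain, which is open and disjoint from `D`. This places the pole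
of the kernel off `closure D`. -/
theorem IsLune.notMem_closure {p : ℝ → ℂ} {D : Set ℂ} (hD : IsLune p D) {a : ℂ}
    (ha : a ∈ ball (0 : ℂ) 1 \ D) (haΓ : a ∉ arcTrace p) : a ∉ closure D := by
  obtain ⟨D', hD', hdisj, hun⟩ := hD.divides
  have haD' : a ∈ D' := (hun ▸ ⟨ha.1, haΓ⟩ : a ∈ D ∪ D').resolve_left ha.2
  intro h
  obtain ⟨x, hx, hx'⟩ := mem_closure_iff.1 h D' hD'.1 haD'
  exact hdisj.le_bot ⟨hx', hx⟩

theorem theorem1 (p : ℝ → ℂ) (D : Set ℂ) (hD : IsLune p D)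
    (γ : ℝ → ℂ) (hγ : ContDiffOn ℝ 1 γ (Ici 0)) (hγ0 : γ 0 = 0)
    (hγD : ∀ t : ℝ, 0 ≤ t → γ t ∈ ball (0 : ℂ) 1 \ D)
    (htrans : TransversalAtStart p γ) :
    (∀ᶠ t : ℝ in 𝓝[>] 0, γ t ∉ arcTrace p) ∧
    ∀ t : ℕ → ℝ, (∀ N, 0 ≤ t N) → Tendsto (fun N => γ (t N)) atTop (𝓝 0) →
      (∀ᶠ N in atTop, γ (t N) ∉ arcTrace p) →
      ∀ u : ℂ → ℂ, DifferentiableOn ℂ u D → ContinuousOn u (closure D) →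
        (∀ᶠ N in atTop, ∀ z ∈ D, ArcIntegrable p (carlemanIntegrand u (γ (t N)) z N)) ∧
        (∀ z ∈ D, Tendsto
          (fun N => 1 / (2 * (Real.pi : ℂ) * Complex.I) *
            arcIntegral p (carlemanIntegrand u (γ (t N)) z N))
          atTop (𝓝 (u z))) ∧
        (∀ K : Set ℂ, K ⊆ D → IsCompact K → TendstoUniformlyOn
          (fun N z => 1 / (2 * (Real.pi : ℂ) * Complex.I) *
            arcIntegral p (carlemanIntegrand u (γ (t N)) z N))
          u atTop K) := by
  refine ⟨hD.isSmoothCrosscut.eventually_notMem_arcTrace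
    ((hγ.differentiableOn one_ne_zero) 0 self_mem_Ici) htrans, fun t ht ht0 htΓ u hu huc => ?_⟩
  have hcl : ∀ᶠ N in atTop, γ (t N) ∉ closure D :=
    htΓ.mono fun N hN => hD.notMem_closure (hγD _ (ht N)) hN
  have hunif : ∀ K : Set ℂ, K ⊆ D → IsCompact K → TendstoUniformlyOn
      (fun N z => 1 / (2 * (Real.pi : ℂ) * Complex.I) *
        arcIntegral p (carlemanIntegrand u (γ (t N)) z N)) u atTop K := by
    intro K hKD hK
    obtain ⟨C, q, δ, hq0, hq1, hδ, h⟩ := hD.exists_norm_carleman_sub_le hu huc hK hKD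
    have hlim : Tendsto (fun N : ℕ => C * q ^ (N + 1)) atTop (𝓝 0) := by
      simpa using ((tendsto_pow_atTop_nhds_zero_of_lt_one hq0 hq1).comp
        (tendsto_add_atTop_nat 1)).const_mul C
    rw [Metric.tendstoUniformlyOn_iff]
    intro ε hε
    filter_upwards [hcl, ht0.eventually (ball_mem_nhds 0 hδ),
      hlim.eventually (gt_mem_nhds hε)] with N h1 h2 h3 z hz
    rw [dist_comm, dist_eq_norm]
    exact (h _ h1 (by simpa using h2) z hz N).trans_lt h3
  refine ⟨hcl.mono fun N hN z hz => hD.arcIntegrable_carlemanIntegrand huc hN hz N,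
    fun z hz => ?_, hunif⟩
  exact (hunif {z} (singleton_subset_iff.2 hz) isCompact_singleton).tendsto_at (mem_singleton z)
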